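/- Let $k\ge 0$, $f\in\mathbb Q^2$ and $r^1,\dots,r^k\in\mathbb Q^2\setminus\{0\}$, and let $R=\{r^1,\dots,r^k\}$. For a matrix $B\in\mathbb R^{3\times 2}$ with rows $b^1,b^2,b^3$ put $$M(B)=\{x\in\mathbb R^2 : b^i\cdot(x-f)\le 1,\ i=1,2,3\},\qquad F_i(B)=M(B)\cap\{x : b^i\cdot(x-f)=1\},$$ $$\psi_B(x)=\max_{i} b^i\cdot x,\qquad \gamma(B)=(\psi_B(r^1),\dots,\psi_B(r^k))\in\mathbb R^k,$$ $$P(B,R)=\Bigl\{f+\tfrac1{\psi_B(r)}\,r : r\in R,\ \psi_B(r)>0\Bigr\}.$$ A convex set in $\mathbb R^2$ is lattice-free if its interior contains no point of $\mathbb Z^2$; it is maximal lattice-free if moreover it is not properly contained in another lattice-free convex set. A split is a set $\{x\in\mathbb R^2:\pi_0\le\pi\cdot x\le\pi_0+1\}$ with $\pi\in\mathbb Z^2\setminus\{0\}$ and $\pi_0\in\mathbb Z$. Let $$\Delta=\{\gamma(B): B\in\mathbb R^{3\times2},\ M(B)\text{ is lattice-free}\},\qquad \Pi=\{\gamma(B):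 B\in\mathbb R^{3\times2},\ M(B)\text{ is a maximal lattice-free split}\}.$$ **Proposition 3.8 (Counting splits).** Let $\Xi_0\subseteq\Pi$ be the set of all $\gamma(B)$ such that $B\in\mathbb R^{3\times 2}$, $M(B)$ is a maximal lattice-free split, and one of the following holds: - Case a: $P(B,R)\subset\mathbb Z^2$. - Case b: there is $j\in\{1,\dots,k\}$ such that $r^j$ lies in the recession cone of $M(B)$. - Case c: $\#\bigl(\operatorname{conv}(P(B,R)\cap F_1(B))\cap\mathbb Z^2\bigr)\ge 2$. (Reordering the rows of $B$ does not change $\gamma(B)$, so here $F_1$ may be any facet of the split.) Then $\Xi_0$ is finite, and for every $\gamma\in\Pi\setminus\Xi_0$ there are $\gamma^1,\gamma^2\in\Delta$ such that $\gamma$ is a strict convex combination of $\gamma^1$ and $\gamma^2$, that is, $\gamma^1\ne\gamma^2$ and $\gamma=\tfrac12(\gamma^1+\gamma^2)$. Moreover, the cardinality of $\Xi_0$ is bounded polynomially in the binary encoding size of $f,r^1,\dots,r^k$: there is a single polynomial $q$, independent of $k$ and of the data, such that $\#\Xi_0\le q(N)$ for all such data, where $N$ is the total binary encoding size of $f,r^1,\dots,r^k$.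 -/

import Mathlib

namespace SplitCounting

open Matrix

/-- The lattice `ℤ²` inside the plane. -/
def intPoints : Set (Fin 2 → ℝ) :=
  {x | ∀ i, ∃ z : ℤ, x i = (z : ℝ)}

/-- A lattice-free convex set: a convex set with no integer point in its interior. -/
def IsLatticeFree (K : Set (Fin 2 → ℝ)) : Prop :=
  Convex ℝ K ∧ Disjoint (interior K) intPoints

/-- A lattice-free convex set that is maximal with respect to inclusion. -/
def IsMaximalLatticeFree (K : Set (Fin 2 → ℝ)) : Prop :=
  Maximal IsLatticeFree K

/-- A split: a strip `π₀ ≤ π · x ≤ π₀ + 1` with `π ∈ ℤ²`, `π₀ ∈ ℤ`. -/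
def IsSplit (K : Set (Fin 2 → ℝ)) : Prop :=
  ∃ (π : Fin 2 → ℤ) (π₀ : ℤ), π ≠ 0 ∧
    K = {x | (π₀ : ℝ) ≤ (fun i => (π i : ℝ)) ⬝ᵥ x ∧ (fun i => (π i : ℝ)) ⬝ᵥ x ≤ (π₀ : ℝ) + 1}

/-- The recession cone of a set `K`. -/
def recessionCone (K : Set (Fin 2 → ℝ)) : Set (Fin 2 → ℝ) :=
  {d | ∀ x ∈ K, ∀ t : ℝ, 0 ≤ t → x + t • d ∈ K}

/-- The polyhedron `M(B) = {x | B (x - f) ≤ e}`, with `e` the all-ones vector. -/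
def M (f : Fin 2 → ℝ) (B : Matrix (Fin 3) (Fin 2) ℝ) : Set (Fin 2 → ℝ) :=
  {x | ∀ i, B i ⬝ᵥ (x - f) ≤ 1}

/-- `F_i(B) = M(B) ∩ {x | bⁱ · (x - f) = 1}`. -/
def F (f : Fin 2 → ℝ) (B : Matrix (Fin 3) (Fin 2) ℝ) (i : Fin 3) : Set (Fin 2 → ℝ) :=
  M f B ∩ {x | B i ⬝ᵥ (x - f) = 1}

/-- The function `ψ_B(x) = max_i bⁱ · x`. -/
noncomputable def psi (B : Matrix (Fin 3) (Fin 2) ℝ) (x : Fin 2 → ℝ) : ℝ :=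
  Finset.univ.sup' Finset.univ_nonempty (fun i => B i ⬝ᵥ x)

/-- The coefficient vector `γ(B) = (ψ_B(r¹), …, ψ_B(rᵏ))`. -/
noncomputable def gam {k : ℕ} (r : Fin k → Fin 2 → ℝ) (B : Matrix (Fin 3) (Fin 2) ℝ) :
    Fin k → ℝ :=
  fun j => psi B (r j)

/-- The set `P(B, R)` of ray intersections `f + (1 / ψ_B(r)) r`, over `r ∈ R` with `ψ_B(r) > 0`. -/
def rayIntersections (f : Fin 2 → ℝ) (B : Matrix (Fin 3) (Fin 2) ℝ) (R : Set (Fin 2 → ℝ)) :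
    Set (Fin 2 → ℝ) :=
  {p | ∃ x ∈ R, 0 < psi B x ∧ p = f + (1 / psi B x) • x}

/-- The set `Δ` of all `γ(B)` with `M(B)` lattice-free. -/
def Delta {k : ℕ} (f : Fin 2 → ℝ) (r : Fin k → Fin 2 → ℝ) : Set (Fin k → ℝ) :=
  {γ | ∃ B : Matrix (Fin 3) (Fin 2) ℝ, IsLatticeFree (M f B) ∧ γ = gam r B}

/-- `M(B)` is a maximal lattice-free split. -/
def IsMaximalSplit (f : Fin 2 → ℝ) (B : Matrix (Fin 3) (Fin 2) ℝ) : Prop :=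
  IsSplit (M f B) ∧ IsMaximalLatticeFree (M f B)

/-- The set `Π` of all `γ(B)` with `M(B)` a maximal lattice-free split. -/
def splitVectors {k : ℕ} (f : Fin 2 → ℝ) (r : Fin k → Fin 2 → ℝ) : Set (Fin k → ℝ) :=
  {γ | ∃ B : Matrix (Fin 3) (Fin 2) ℝ, IsMaximalSplit f B ∧ γ = gam r B}

/-- All ray intersections are integral. -/
def CaseA {k : ℕ} (f : Fin 2 → ℝ) (r : Fin k → Fin 2 → ℝ) (B : Matrix (Fin 3) (Fin 2) ℝ) : Prop :=
  rayIntersections f B (Set.range r) ⊆ intPoints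

/-- Some ray lies in the recession cone of `M(B)`. -/
def CaseB {k : ℕ} (f : Fin 2 → ℝ) (r : Fin k → Fin 2 → ℝ) (B : Matrix (Fin 3) (Fin 2) ℝ) : Prop :=
  ∃ j, r j ∈ recessionCone (M f B)

/-- The hull of the ray intersections on the facet `F_1(B)` (row index `0` here) contains at least
two integer points. Permuting the rows of `B` changes neither `M(B)` nor `γ(B)`, so in a set
of vectors `γ(B)`, with `B` ranging over all matrices, the first facet stands for any facet. -/
def CaseC {k : ℕ} (f : Fin 2 → ℝ) (r : Fin k → Fin 2 → ℝ) (B : Matrix (Fin 3) (Fin 2) ℝ) : Prop :=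
  2 ≤ (convexHull ℝ (rayIntersections f B (Set.range r) ∩ F f B 0) ∩ intPoints).encard

/-- The set `Ξ₀` of all `γ(B)` with `M(B)` a maximal lattice-free split in one of the three cases. -/
def Xi0 {k : ℕ} (f : Fin 2 → ℝ) (r : Fin k → Fin 2 → ℝ) : Set (Fin k → ℝ) :=
  {γ | ∃ B : Matrix (Fin 3) (Fin 2) ℝ, IsMaximalSplit f B ∧
    (CaseA f r B ∨ CaseB f r B ∨ CaseC f r B) ∧ γ = gam r B}

/-- `x` is a strict convex combination of `y₁` and `y₂`: it is the midpoint of two distinct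
points. -/
def IsStrictConvexComb {k : ℕ} (x y₁ y₂ : Fin k → ℝ) : Prop :=
  y₁ ≠ y₂ ∧ x = (1 / 2 : ℝ) • (y₁ + y₂)

/-- A rational vector as a real vector. -/
def toReal (v : Fin 2 → ℚ) : Fin 2 → ℝ := fun i => (v i : ℝ)

/-- Binary encoding size of a rational number `p / q` in lowest terms:
`1 + ⌈log₂ (|p| + 1)⌉ + ⌈log₂ (q + 1)⌉` (`Nat.size` is the number of binary digits). -/
def ratSize (q : ℚ) : ℕ := 1 + Nat.size q.num.natAbs + Nat.size q.den

/-- Binary encoding size of a rational vector in the plane. -/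
def vecSize (v : Fin 2 → ℚ) : ℕ := 2 + ∑ i, ratSize (v i)

/-- Total binary encoding size of the input data `f, r¹, …, rᵏ`. -/
def inputSize {k : ℕ} (f : Fin 2 → ℚ) (r : Fin k → Fin 2 → ℚ) : ℕ :=
  vecSize f + ∑ j, vecSize (r j)

end SplitCounting

namespace SplitCounting

open Matrix

/-! A split `M(B)` that is maximal lattice-free is the strip of a coprime integer normal `π` with
`f` strictly inside, and `ψ_B` is the gauge of that strip about `f`
(`IsMaximalSplit.exists_coprime`). Hence `γ(B)` depends only on `±π`.

Outside `Ξ₀`, no ray is parallel to the strip and some ray leaves it at a nonintegral point of a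
facet. As that facet is not in Case c, it carries an integer point `z` such that all ray
intersections on it are less than one lattice step from `z`. Rotate the facet about `z` by a small
slope `±ε`. On one side this lets in integer points, which a third facet through the lattice
neighbour of `z` cuts off again (`isLatticeFree_tilt`). For small `ε` the third row is inactive on
the rays, so `γ` changes by `∓ε` times a fixed vector, nonzero at the nonintegral ray; the two
rotations average to `γ` (`exists_strictConvexComb_of_tilt`).

For the count, `Ξ₀` is covered by families with at most one member each. If a ray is parallel to the
strip, it fixes `±π`. If no ray is parallel and all intersections are integral, the gauges are
forced, since an intersection further in would be an integer point inside another split. In Case c,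
two integer points of the facet lie in the cone at `f` spanned by two rays, and the extreme such
points are corners of that cone. A corner is determined by the binary lengths of its two cone
coordinates (`IsCorner.eq_of_label_eq`), two corners fix `±π`, and there are only polynomially many
such lengths. The total is `1 + k + k²(3N + 2)⁴`. -/

/-! ### Integer normals, strips and their gauges -/

/-- An integer vector as a real vector. -/
def intVec (z : Fin 2 → ℤ) : Fin 2 → ℝ := fun i => (z i : ℝ)

lemma dot_eq (a x : Fin 2 → ℝ) : a ⬝ᵥ x = a 0 * x 0 + a 1 * x 1 := by
  simp [dotProduct, Fin.sum_univ_two]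

lemma intVec_mem (z : Fin 2 → ℤ) : intVec z ∈ intPoints := fun i => ⟨z i, rfl⟩

lemma exists_intVec_of_mem {x : Fin 2 → ℝ} (hx : x ∈ intPoints) : ∃ z, x = intVec z := by
  choose z hz using hx
  exact ⟨z, funext hz⟩

lemma intVec_dot (π z : Fin 2 → ℤ) :
    intVec π ⬝ᵥ intVec z = ((π 0 * z 0 + π 1 * z 1 : ℤ) : ℝ) := by
  rw [dot_eq]; simp [intVec]

lemma intVec_neg (π : Fin 2 → ℤ) : intVec (-π) = -intVec π := by
  ext i; simp [intVec]

/-- The strip `c ≤ π · x ≤ c + 1`. -/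
def strip (π : Fin 2 → ℤ) (c : ℤ) : Set (Fin 2 → ℝ) :=
  {x | (c : ℝ) ≤ intVec π ⬝ᵥ x ∧ intVec π ⬝ᵥ x ≤ (c : ℝ) + 1}

/-- The gauge of the strip with normal `π` around `f`, with respect to `f`. -/
noncomputable def splitGauge (f : Fin 2 → ℝ) (π : Fin 2 → ℤ) (r : Fin 2 → ℝ) : ℝ :=
  max (intVec π ⬝ᵥ r / (1 - Int.fract (intVec π ⬝ᵥ f)))
    (-(intVec π ⬝ᵥ r) / Int.fract (intVec π ⬝ᵥ f))

lemma splitGauge_neg {f : Fin 2 → ℝ} {π : Fin 2 → ℤ} (h : Int.fract (intVec π ⬝ᵥ f) ≠ 0)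
    (r : Fin 2 → ℝ) : splitGauge f (-π) r = splitGauge f π r := by
  unfold splitGauge
  rw [intVec_neg, neg_dotProduct, neg_dotProduct, Int.fract_neg h, max_comm]
  simp

lemma floor_neg_of_fract_ne_zero {x : ℝ} (h : Int.fract x ≠ 0) :
    ((⌊-x⌋ : ℤ) : ℝ) = -⌊x⌋ - 1 := by
  have h1 := Int.self_sub_floor (-x)
  have h2 := Int.self_sub_floor x
  rw [Int.fract_neg h] at h1
  linarith

lemma strip_neg {f : Fin 2 → ℝ} {π : Fin 2 → ℤ} (h : Int.fract (intVec π ⬝ᵥ f) ≠ 0) :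
    strip (-π) ⌊intVec (-π) ⬝ᵥ f⌋ = strip π ⌊intVec π ⬝ᵥ f⌋ := by
  have e := floor_neg_of_fract_ne_zero h
  ext x
  simp only [strip, Set.mem_ofPred_eq, intVec_neg π, neg_dotProduct, e]
  constructor <;> rintro ⟨h1, h2⟩ <;> constructor <;> linarith

lemma fract_neg_ne {f : Fin 2 → ℝ} {π : Fin 2 → ℤ} (h : Int.fract (intVec π ⬝ᵥ f) ≠ 0) :
    Int.fract (intVec (-π) ⬝ᵥ f) ≠ 0 := by
  rw [intVec_neg, neg_dotProduct]
  exact fun h' => h (Int.fract_neg_eq_zero.1 h')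

/-- A Bézout combination gives an integer `m` with `π' = m π`; the Bézout identity for `π'` makes
`m` a unit. -/
lemma eq_or_eq_neg_of_coprime {π π' : Fin 2 → ℤ} (h : IsCoprime (π 0) (π 1))
    (h' : IsCoprime (π' 0) (π' 1)) (hp : π 0 * π' 1 = π 1 * π' 0) : π' = π ∨ π' = -π := by
  obtain ⟨u, v, huv⟩ := h
  obtain ⟨u', v', huv'⟩ := h'
  set m := u * π' 0 + v * π' 1 with hm
  have h0 : π' 0 = m * π 0 := by linear_combination (-π' 0) * huv - v * hp
  have h1 : π' 1 = m * π 1 := by linear_combination (-π' 1) * huv + u * hp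
  have hu : IsUnit m := by
    refine IsUnit.of_mul_eq_one (u' * π 0 + v' * π 1) ?_
    rw [h0, h1] at huv'
    linarith
  rcases Int.isUnit_iff.1 hu with e | e <;> rw [e] at h0 h1
  · left; ext i; fin_cases i <;> simp [h0, h1]
  · right; ext i; fin_cases i <;> simp [h0, h1]

lemma eq_or_eq_neg_of_perp {π π' : Fin 2 → ℤ} (h : IsCoprime (π 0) (π 1))
    (h' : IsCoprime (π' 0) (π' 1)) {d : Fin 2 → ℝ} (hd : d ≠ 0)
    (hp : intVec π ⬝ᵥ d = 0) (hp' : intVec π' ⬝ᵥ d = 0) : π' = π ∨ π' = -π := by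
  apply eq_or_eq_neg_of_coprime h h'
  rw [dot_eq] at hp hp'
  simp only [intVec] at hp hp'
  have : ((π 0 : ℝ) * π' 1 - π 1 * π' 0) = 0 := by
    by_contra hne
    apply hd
    ext i
    fin_cases i
    · have : ((π 0 : ℝ) * π' 1 - π 1 * π' 0) * d 0 = 0 := by
        linear_combination (π' 1 : ℝ) * hp - (π 1 : ℝ) * hp'
      simpa [hne] using this
    · have : ((π 0 : ℝ) * π' 1 - π 1 * π' 0) * d 1 = 0 := by
        linear_combination (π 0 : ℝ) * hp' - (π' 0 : ℝ) * hp
      simpa [hne] using this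
  exact_mod_cast sub_eq_zero.1 this

lemma splitGauge_eq_of_perp {f : Fin 2 → ℝ} {π π' : Fin 2 → ℤ} (h : IsCoprime (π 0) (π 1))
    (hf : Int.fract (intVec π ⬝ᵥ f) ≠ 0)
    (h' : IsCoprime (π' 0) (π' 1)) {d : Fin 2 → ℝ} (hd : d ≠ 0)
    (hp : intVec π ⬝ᵥ d = 0) (hp' : intVec π' ⬝ᵥ d = 0) : splitGauge f π' = splitGauge f π := by
  rcases eq_or_eq_neg_of_perp h h' hd hp hp' with rfl | rfl
  · rfl
  · exact funext fun r => splitGauge_neg hf r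

/-! ### Interiors, and primitivity of the normal of a maximal split -/

lemma exists_pos_mem_of_mem_interior {K : Set (Fin 2 → ℝ)} {x : Fin 2 → ℝ} (hx : x ∈ interior K)
    (v : Fin 2 → ℝ) : ∃ t : ℝ, 0 < t ∧ x + t • v ∈ K := by
  have hc : Filter.Tendsto (fun t : ℝ => x + t • v) (nhdsWithin 0 (Set.Ioi 0)) (nhds x) := by
    have : Continuous (fun t : ℝ => x + t • v) := by fun_prop
    have h := (this.tendsto 0).mono_left (nhdsWithin_le_nhds (s := Set.Ioi 0))
    simpa using h
  obtain ⟨t, ht, ht'⟩ :=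
    ((hc.eventually_mem (mem_interior_iff_mem_nhds.1 hx)).and self_mem_nhdsWithin).exists
  exact ⟨t, ht', ht⟩

lemma dot_self_pos {a : Fin 2 → ℝ} (ha : a ≠ 0) : 0 < a ⬝ᵥ a := by
  rw [dot_eq]
  by_contra h
  apply ha
  have h0 : a 0 = 0 := by nlinarith [mul_self_nonneg (a 0), mul_self_nonneg (a 1)]
  have h1 : a 1 = 0 := by nlinarith [mul_self_nonneg (a 0), mul_self_nonneg (a 1)]
  ext i; fin_cases i
  · exact h0
  · exact h1

lemma intVec_ne_zero {π : Fin 2 → ℤ} (hπ : π ≠ 0) : intVec π ≠ 0 := by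
  intro h
  apply hπ
  ext i
  have := congrFun h i
  simpa [intVec] using this

lemma dot_lt_of_mem_interior {K : Set (Fin 2 → ℝ)} {x a : Fin 2 → ℝ} {c : ℝ}
    (hx : x ∈ interior K) (ha : a ≠ 0) (hK : ∀ y ∈ K, a ⬝ᵥ y ≤ c) : a ⬝ᵥ x < c := by
  obtain ⟨t, ht, hm⟩ := exists_pos_mem_of_mem_interior hx a
  have := hK _ hm
  rw [dotProduct_add, dotProduct_smul, smul_eq_mul] at this
  nlinarith [mul_pos ht (dot_self_pos ha)]

/-- Moving from `x` away from `f`, rather than along the row, also covers a zero row. -/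
lemma row_lt_of_mem_interior {f x : Fin 2 → ℝ} {B : Matrix (Fin 3) (Fin 2) ℝ}
    (hx : x ∈ interior (M f B)) (i : Fin 3) : B i ⬝ᵥ (x - f) < 1 := by
  obtain ⟨t, ht, hm⟩ := exists_pos_mem_of_mem_interior hx (x - f)
  have := hm i
  rw [show x + t • (x - f) - f = (1 + t) • (x - f) by module, dotProduct_smul,
    smul_eq_mul] at this
  nlinarith

lemma convex_M (f : Fin 2 → ℝ) (B : Matrix (Fin 3) (Fin 2) ℝ) : Convex ℝ (M f B) := by
  intro x hx y hy a b ha hb hab i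
  have : a • x + b • y - f = a • (x - f) + b • (y - f) := by
    rw [show b = 1 - a by linarith]; module
  rw [this, dotProduct_add, dotProduct_smul, dotProduct_smul, smul_eq_mul, smul_eq_mul]
  nlinarith [hx i, hy i]

lemma isLatticeFree_strip {π : Fin 2 → ℤ} (hπ : π ≠ 0) (c : ℤ) : IsLatticeFree (strip π c) := by
  have hπ' := intVec_ne_zero hπ
  refine ⟨?_, ?_⟩
  · intro x hx y hy a b ha hb hab
    simp only [strip, Set.mem_ofPred_eq, dotProduct_add, dotProduct_smul, smul_eq_mul] at *
    obtain rfl : b = 1 - a := by linarith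
    constructor <;> nlinarith
  · rw [Set.disjoint_left]
    intro x hx hi
    obtain ⟨z, rfl⟩ := exists_intVec_of_mem hi
    have h1 := dot_lt_of_mem_interior hx hπ' (fun y hy => hy.2)
    have h2 := dot_lt_of_mem_interior (c := -(c : ℝ)) hx (neg_ne_zero.2 hπ') (fun y hy => by
      rw [neg_dotProduct]; linarith [hy.1])
    rw [neg_dotProduct] at h2
    rw [intVec_dot] at h1 h2
    have h3 : π 0 * z 0 + π 1 * z 1 < c + 1 := by exact_mod_cast h1
    have h4 : c < π 0 * z 0 + π 1 * z 1 := by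
      have : (c : ℝ) < _ := neg_lt_neg_iff.1 h2
      exact_mod_cast this
    omega

/-- If `g` is the gcd, the strip of `π / g` at the rounded-down level `c / g` contains the given
one, because no multiple of `g` lies strictly between `c` and `c + 1`. It is `g` times as wide and
still lattice-free, so maximality forces `g = 1`. -/
lemma isCoprime_of_isMaximal_strip {π : Fin 2 → ℤ} {c : ℤ} (hπ : π ≠ 0)
    (h : IsMaximalLatticeFree (strip π c)) : IsCoprime (π 0) (π 1) := by
  rw [Int.isCoprime_iff_gcd_eq_one]
  set g := Int.gcd (π 0) (π 1) with hg
  have hg0 : g ≠ 0 := by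
    intro h0
    rw [hg, Int.gcd_eq_zero_iff] at h0
    apply hπ; ext i; fin_cases i
    · exact h0.1
    · exact h0.2
  obtain ⟨p0, e0⟩ : (g : ℤ) ∣ π 0 := Int.gcd_dvd_left ..
  obtain ⟨p1, e1⟩ : (g : ℤ) ∣ π 1 := Int.gcd_dvd_right ..
  set π' : Fin 2 → ℤ := ![p0, p1] with hπ'
  have hgpos : (0 : ℝ) < g := by exact_mod_cast Nat.pos_of_ne_zero hg0
  have e : ∀ x, intVec π ⬝ᵥ x = g * (intVec π' ⬝ᵥ x) := by
    intro x
    rw [dot_eq, dot_eq]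
    simp only [intVec, e0, e1, hπ']
    push_cast
    ring
  have hne : π' ≠ 0 := by
    intro h0
    apply hπ
    have h00 := congrFun h0 0
    have h01 := congrFun h0 1
    have h00' : p0 = 0 := h00
    have h01' : p1 = 0 := h01
    ext i; fin_cases i <;> simp [e0, e1, h00', h01']
  set c' : ℤ := c / g
  have hgz : (0 : ℤ) < g := by exact_mod_cast Nat.pos_of_ne_zero hg0
  have hc1 : c' * g ≤ c := Int.ediv_mul_le c hgz.ne'
  have hc2 : c + 1 ≤ (c' + 1) * g := by
    have := Int.lt_ediv_add_one_mul_self c hgz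
    linarith
  have hc1' : (c' : ℝ) * g ≤ c := by exact_mod_cast hc1
  have hc2' : (c : ℝ) + 1 ≤ (c' + 1) * g := by exact_mod_cast hc2
  have hsub : strip π c ⊆ strip π' c' := by
    intro x hx
    obtain ⟨h1, h2⟩ := hx
    rw [e] at h1 h2
    constructor
    · by_contra hh
      push Not at hh
      nlinarith
    · by_contra hh
      push Not at hh
      nlinarith
  have hback : strip π' c' ⊆ strip π c := h.2 (isLatticeFree_strip hne c') hsub
  have hpp := dot_self_pos (intVec_ne_zero hne)
  have key : ∀ s : ℝ, intVec π' ⬝ᵥ ((s / (intVec π' ⬝ᵥ intVec π')) • intVec π') = s := by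
    intro s
    rw [dotProduct_smul, smul_eq_mul, div_mul_cancel₀ _ hpp.ne']
  have m1 := hback (show (((c' : ℝ) / (intVec π' ⬝ᵥ intVec π')) • intVec π') ∈ strip π' c' by
    simp only [strip, Set.mem_ofPred_eq, key]; constructor <;> linarith)
  have m2 := hback (show (((c' + 1 : ℝ) / (intVec π' ⬝ᵥ intVec π')) • intVec π') ∈ strip π' c' by
    simp only [strip, Set.mem_ofPred_eq, key]; constructor <;> linarith)
  have l1 := m1.1
  have l2 := m2.2
  rw [e, key] at l1 l2
  have : (g : ℝ) ≤ 1 := by linarith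
  have : g ≤ 1 := by exact_mod_cast this
  omega

/-! ### The function `ψ_B` of a split is the gauge of its strip -/

lemma row_le_psi (B : Matrix (Fin 3) (Fin 2) ℝ) (x : Fin 2 → ℝ) (i : Fin 3) :
    B i ⬝ᵥ x ≤ psi B x :=
  Finset.le_sup' (fun i => B i ⬝ᵥ x) (Finset.mem_univ i)

lemma psi_le_iff (B : Matrix (Fin 3) (Fin 2) ℝ) (x : Fin 2 → ℝ) (c : ℝ) :
    psi B x ≤ c ↔ ∀ i, B i ⬝ᵥ x ≤ c := by
  simp [psi]

lemma add_smul_mem_M_iff (f : Fin 2 → ℝ) (B : Matrix (Fin 3) (Fin 2) ℝ) (r : Fin 2 → ℝ)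
    {t : ℝ} (ht : 0 < t) : f + t • r ∈ M f B ↔ t * psi B r ≤ 1 := by
  rw [← le_div_iff₀' ht, psi_le_iff]
  simp only [M, Set.mem_ofPred_eq, add_sub_cancel_left, dotProduct_smul, smul_eq_mul]
  exact forall_congr' fun i => (le_div_iff₀' ht).symm

lemma add_smul_mem_strip_iff {f : Fin 2 → ℝ} {π : Fin 2 → ℤ}
    (hf : Int.fract (intVec π ⬝ᵥ f) ≠ 0) (r : Fin 2 → ℝ) {t : ℝ} (ht : 0 < t) :
    f + t • r ∈ strip π ⌊intVec π ⬝ᵥ f⌋ ↔ t * splitGauge f π r ≤ 1 := by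
  have h0 : 0 < Int.fract (intVec π ⬝ᵥ f) := lt_of_le_of_ne (Int.fract_nonneg _) hf.symm
  have h1 : 0 < 1 - Int.fract (intVec π ⬝ᵥ f) := by linarith [Int.fract_lt_one (intVec π ⬝ᵥ f)]
  have h2 := Int.self_sub_floor (intVec π ⬝ᵥ f)
  rw [← le_div_iff₀' ht, splitGauge, max_le_iff, div_le_iff₀ h1, div_le_iff₀ h0,
    div_mul_eq_mul_div, div_mul_eq_mul_div, le_div_iff₀ ht, le_div_iff₀ ht]
  simp only [strip, Set.mem_ofPred_eq, dotProduct_add, dotProduct_smul, smul_eq_mul]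
  constructor <;> rintro ⟨a, b⟩ <;> constructor <;> linarith

lemma splitGauge_nonneg {f : Fin 2 → ℝ} {π : Fin 2 → ℤ} (r : Fin 2 → ℝ) :
    0 ≤ splitGauge f π r := by
  have h0 := Int.fract_nonneg (intVec π ⬝ᵥ f)
  have h1 : 0 ≤ 1 - Int.fract (intVec π ⬝ᵥ f) := by linarith [Int.fract_lt_one (intVec π ⬝ᵥ f)]
  rcases le_total 0 (intVec π ⬝ᵥ r) with h | h
  · exact le_max_of_le_left (div_nonneg h h1)
  · exact le_max_of_le_right (div_nonneg (by linarith) h0)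

lemma splitGauge_eq_zero_iff {f : Fin 2 → ℝ} {π : Fin 2 → ℤ}
    (hf : Int.fract (intVec π ⬝ᵥ f) ≠ 0) (r : Fin 2 → ℝ) :
    splitGauge f π r = 0 ↔ intVec π ⬝ᵥ r = 0 := by
  have h0 : 0 < Int.fract (intVec π ⬝ᵥ f) := lt_of_le_of_ne (Int.fract_nonneg _) hf.symm
  have h1 : 0 < 1 - Int.fract (intVec π ⬝ᵥ f) := by linarith [Int.fract_lt_one (intVec π ⬝ᵥ f)]
  constructor
  · intro h
    have a := (le_max_left _ _).trans h.le
    have b := (le_max_right _ _).trans h.le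
    rw [div_le_iff₀ h1] at a
    rw [div_le_iff₀ h0] at b
    linarith
  · intro h
    simp [splitGauge, h]

/-- Membership of `f + t r` for `t > 0` determines only the positive part of `ψ_B`. Equality
therefore needs an extra argument where the gauge vanishes. -/
lemma psi_eq_splitGauge {f : Fin 2 → ℝ} {B : Matrix (Fin 3) (Fin 2) ℝ} {π : Fin 2 → ℤ}
    (hf : Int.fract (intVec π ⬝ᵥ f) ≠ 0) (hM : M f B = strip π ⌊intVec π ⬝ᵥ f⌋)
    (r : Fin 2 → ℝ) : psi B r = splitGauge f π r := by
  have key : ∀ (r : Fin 2 → ℝ) (t : ℝ), 0 < t → (t * psi B r ≤ 1 ↔ t * splitGauge f π r ≤ 1) := by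
    intro r t ht
    rw [← add_smul_mem_M_iff f B r ht, hM, add_smul_mem_strip_iff hf r ht]
  have hle : ∀ r, psi B r ≤ splitGauge f π r := by
    intro r
    by_contra hlt
    push Not at hlt
    have hp : 0 < psi B r := (splitGauge_nonneg r).trans_lt hlt
    have hs : 0 < (psi B r + splitGauge f π r) / 2 := by
      linarith [splitGauge_nonneg (f := f) (π := π) r]
    have h1 : ((psi B r + splitGauge f π r) / 2)⁻¹ * splitGauge f π r ≤ 1 := by
      rw [inv_mul_le_iff₀ hs]; linarith
    have h2 := (key r _ (inv_pos.2 hs)).2 h1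
    rw [inv_mul_le_iff₀ hs] at h2
    linarith
  apply le_antisymm (hle r)
  -- On a parallel direction the gauge is zero at `r` and at `-r`, so each row is nonpositive on
  -- both and hence zero.
  rcases (splitGauge_nonneg (f := f) (π := π) r).eq_or_lt with h | h
  · rw [← h]
    have h0 := (splitGauge_eq_zero_iff hf r).1 h.symm
    have h1 : psi B (-r) ≤ 0 := by
      have := hle (-r)
      rwa [(splitGauge_eq_zero_iff hf (-r)).2 (by rw [dotProduct_neg, h0, neg_zero])] at this
    have h2 := (row_le_psi B (-r) 0).trans h1
    rw [dotProduct_neg] at h2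
    linarith [row_le_psi B r 0]
  · by_contra hlt
    push Not at hlt
    obtain ⟨u, hu1, hu2⟩ := exists_between (max_lt hlt h)
    have hu : 0 < u := (le_max_right _ _).trans_lt hu1
    have h1 : u⁻¹ * psi B r ≤ 1 := by
      rw [inv_mul_le_iff₀ hu]; linarith [le_max_left (psi B r) 0]
    have h2 := (key r _ (inv_pos.2 hu)).1 h1
    rw [inv_mul_le_iff₀ hu] at h2
    linarith

lemma fract_ne_zero_of_M_eq_strip {f : Fin 2 → ℝ} {B : Matrix (Fin 3) (Fin 2) ℝ}
    {π : Fin 2 → ℤ} {c : ℤ} (hπ : π ≠ 0) (hM : M f B = strip π c) :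
    ⌊intVec π ⬝ᵥ f⌋ = c ∧ Int.fract (intVec π ⬝ᵥ f) ≠ 0 := by
  have hπ' := intVec_ne_zero hπ
  have hf : f ∈ interior (M f B) := by
    have ho : IsOpen {x : Fin 2 → ℝ | ∀ i, B i ⬝ᵥ (x - f) < 1} := by
      simp only [Set.ofPred_forall]
      refine isOpen_iInter_of_finite fun i => isOpen_lt ?_ continuous_const
      simp only [dot_eq]
      fun_prop
    refine mem_interior.2 ⟨_, fun x hx i => (hx i).le, ho, fun i => ?_⟩
    simp
  rw [hM] at hf
  have h1 := dot_lt_of_mem_interior hf hπ' (fun y hy => hy.2)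
  have h2 := dot_lt_of_mem_interior (c := -(c : ℝ)) hf (neg_ne_zero.2 hπ') (fun y hy => by
      rw [neg_dotProduct]; linarith [hy.1])
  rw [neg_dotProduct] at h2
  have e : ⌊intVec π ⬝ᵥ f⌋ = c := Int.floor_eq_iff.2 ⟨by linarith, h1⟩
  refine ⟨e, ?_⟩
  rw [← Int.self_sub_floor, e]
  intro h
  linarith

lemma IsMaximalSplit.exists_coprime {f : Fin 2 → ℝ} {B : Matrix (Fin 3) (Fin 2) ℝ}
    (h : IsMaximalSplit f B) :
    ∃ π : Fin 2 → ℤ, IsCoprime (π 0) (π 1) ∧ Int.fract (intVec π ⬝ᵥ f) ≠ 0 ∧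
      M f B = strip π ⌊intVec π ⬝ᵥ f⌋ ∧ ∀ r, psi B r = splitGauge f π r := by
  obtain ⟨⟨π, c, hπ, hM⟩, hmax⟩ := h
  have hM' : M f B = strip π c := hM
  obtain ⟨e, hf⟩ := fract_ne_zero_of_M_eq_strip hπ hM'
  refine ⟨π, isCoprime_of_isMaximal_strip hπ (hM' ▸ hmax), hf, by rw [e, hM'], ?_⟩
  exact psi_eq_splitGauge hf (by rw [e, hM'])

/-! ### Tilting a facet of a split -/

lemma psi_cons (a b c x : Fin 2 → ℝ) :
    psi ![a, b, c] x = max (max (a ⬝ᵥ x) (b ⬝ᵥ x)) (c ⬝ᵥ x) := by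
  apply le_antisymm
  · exact (psi_le_iff _ _ _).2 (Fin.forall_fin_succ.2 ⟨le_max_of_le_left (le_max_left _ _),
      Fin.forall_fin_two.2 ⟨le_max_of_le_left (le_max_right _ _), le_max_right _ _⟩⟩)
  · refine max_le (max_le ?_ ?_) ?_
    · exact row_le_psi ![a, b, c] x 0
    · exact row_le_psi ![a, b, c] x 1
    · exact row_le_psi ![a, b, c] x 2

lemma mem_M_cons {f a b c x : Fin 2 → ℝ} :
    x ∈ M f ![a, b, c] ↔ a ⬝ᵥ (x - f) ≤ 1 ∧ b ⬝ᵥ (x - f) ≤ 1 ∧ c ⬝ᵥ (x - f) ≤ 1 := by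
  simp only [M, Set.mem_ofPred_eq, Fin.forall_fin_succ]
  simp

/-- The matrix obtained from a split with facet normals `σ` and `-c • σ` by tilting the first
facet with slope `ε`, and cutting with the first facet tilted with slope `η` the other way. -/
def tilt (σ τ : Fin 2 → ℝ) (c ε η : ℝ) : Matrix (Fin 3) (Fin 2) ℝ :=
  ![σ - ε • τ, -(c • σ), σ + η • (τ - σ)]

/-- On the line `σ = 1` the first row leaves only `τ > 0` in the interior and the third only `τ <
1`, so no integer value of `τ` survives. -/
lemma isLatticeFree_tilt {f σ τ : Fin 2 → ℝ} {c ε η : ℝ}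
    (hσ : ∀ x ∈ intPoints, c * (σ ⬝ᵥ (x - f)) ≤ -1 ∨
      (σ ⬝ᵥ (x - f) = 1 ∧ ∃ n : ℤ, τ ⬝ᵥ (x - f) = n) ∨ 2 ≤ σ ⬝ᵥ (x - f))
    (hε : 0 < ε) (hε1 : ε ≤ 1) (hη : 0 < η) (hη1 : η ≤ 1) :
    IsLatticeFree (M f (tilt σ τ c ε η)) := by
  refine ⟨convex_M _ _, Set.disjoint_left.2 fun x hx hi => ?_⟩
  have h0 : (σ - ε • τ) ⬝ᵥ (x - f) < 1 := row_lt_of_mem_interior hx 0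
  have h1 : (-(c • σ)) ⬝ᵥ (x - f) < 1 := row_lt_of_mem_interior hx 1
  have h2 : (σ + η • (τ - σ)) ⬝ᵥ (x - f) < 1 := row_lt_of_mem_interior hx 2
  simp only [sub_dotProduct, add_dotProduct, neg_dotProduct, smul_dotProduct, smul_eq_mul]
    at h0 h1 h2
  rcases hσ x hi with h | ⟨h, n, hn⟩ | h
  · linarith
  · rw [h, hn] at h0 h2
    have a : (0 : ℝ) < n := by
      by_contra hh
      push Not at hh
      nlinarith
    have b : (n : ℝ) < 1 := by
      by_contra hh
      push Not at hh
      nlinarith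
    have a' : 0 < n := by exact_mod_cast a
    have b' : n < 1 := by exact_mod_cast b
    omega
  -- Beyond the facet, the first row gives `t > s - 1`; the third then gives `s < 1 + η ≤ 2`.
  · set s := σ ⬝ᵥ (x - f)
    set t := τ ⬝ᵥ (x - f)
    have ht : s - 1 < t := by
      by_contra hh
      push Not at hh
      nlinarith
    nlinarith

lemma psi_tilt_of_pos {σ τ r : Fin 2 → ℝ} {c ε η : ℝ} (hc : 0 < c) (hε1 : ε ≤ 1)
    (hε : 0 < ε) (hs : 0 < σ ⬝ᵥ r) (ht : τ ⬝ᵥ r < σ ⬝ᵥ r)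
    (h : ε * (τ ⬝ᵥ r) ≤ η * (σ ⬝ᵥ r - τ ⬝ᵥ r)) :
    psi (tilt σ τ c ε η) r = σ ⬝ᵥ r - ε * (τ ⬝ᵥ r) := by
  rw [tilt, psi_cons]
  simp only [sub_dotProduct, add_dotProduct, neg_dotProduct, smul_dotProduct, smul_eq_mul]
  rw [max_eq_left, max_eq_left]
  · nlinarith [mul_pos hc hs]
  · rw [max_eq_left]
    · linarith
    · nlinarith [mul_pos hc hs]

lemma psi_tilt_of_neg {σ τ r : Fin 2 → ℝ} {c ε η : ℝ}
    (h1 : ε * |τ ⬝ᵥ r| ≤ (1 + c) * |σ ⬝ᵥ r|) (hε : 0 < ε) (hη : 0 < η) (hs : σ ⬝ᵥ r < 0)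
    (h2 : η * (|τ ⬝ᵥ r| + |σ ⬝ᵥ r|) ≤ (1 + c) * |σ ⬝ᵥ r|) :
    psi (tilt σ τ c ε η) r = -(c * (σ ⬝ᵥ r)) := by
  rw [abs_of_neg hs] at h1 h2
  have a1 := mul_le_mul_of_nonneg_left (le_abs_self (τ ⬝ᵥ r)) hη.le
  have a2 := mul_le_mul_of_nonneg_left (neg_abs_le (τ ⬝ᵥ r)) hε.le
  rw [tilt, psi_cons]
  simp only [sub_dotProduct, add_dotProduct, neg_dotProduct, smul_dotProduct, smul_eq_mul]
  rw [max_eq_left, max_eq_right]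
  · linarith
  · rw [max_eq_right]
    · linarith
    · linarith

lemma exists_pos_le_one_mul_le {ι : Type*} [Finite ι] (A B : ι → ℝ) (hB : ∀ i, 0 < B i) :
    ∃ ε : ℝ, 0 < ε ∧ ε ≤ 1 ∧ ∀ i, ε * A i ≤ B i := by
  have h : ∀ᶠ ε : ℝ in nhds 0, ∀ i, ε * A i < B i := by
    rw [Filter.eventually_all]
    intro i
    have : Continuous fun ε : ℝ => ε * A i := by fun_prop
    exact this.continuousAt.eventually_lt continuousAt_const (by simpa using hB i)
  have h1 : ∀ᶠ ε : ℝ in nhdsWithin 0 (Set.Ioi 0), ε < 1 :=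
    nhdsWithin_le_nhds (eventually_lt_nhds one_pos)
  obtain ⟨ε, ⟨h2, h3⟩, h4⟩ :=
    (((h.filter_mono nhdsWithin_le_nhds).and h1).and self_mem_nhdsWithin).exists
  exact ⟨ε, h4, h3.le, fun i => (h2 i).le⟩

lemma exists_strictConvexComb_of_tilt {k : ℕ} {f : Fin 2 → ℝ} {r : Fin k → Fin 2 → ℝ}
    {γ : Fin k → ℝ} {σ τ : Fin 2 → ℝ} {c : ℝ} (hc : 0 < c)
    (hσ : ∀ x ∈ intPoints, c * (σ ⬝ᵥ (x - f)) ≤ -1 ∨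
      (σ ⬝ᵥ (x - f) = 1 ∧ ∃ n : ℤ, τ ⬝ᵥ (x - f) = n) ∨ 2 ≤ σ ⬝ᵥ (x - f))
    (hγ : ∀ j, γ j = max (σ ⬝ᵥ r j) (-(c * (σ ⬝ᵥ r j))))
    (h0 : ∀ j, σ ⬝ᵥ r j ≠ 0) (hτ : ∀ j, 0 < σ ⬝ᵥ r j → |τ ⬝ᵥ r j| < σ ⬝ᵥ r j)
    (hne : ∃ j, 0 < σ ⬝ᵥ r j ∧ τ ⬝ᵥ r j ≠ 0) :
    ∃ γ₁ ∈ Delta f r, ∃ γ₂ ∈ Delta f r, IsStrictConvexComb γ γ₁ γ₂ := by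
  -- The slope `η` is fixed first, since the bound on `ε` that keeps the third row inactive on the
  -- rays depends on it.
  obtain ⟨η, hη, hη1, hη'⟩ := exists_pos_le_one_mul_le
    (fun j => |τ ⬝ᵥ r j| + |σ ⬝ᵥ r j|) (fun j => (1 + c) * |σ ⬝ᵥ r j|)
    (fun j => mul_pos (by linarith) (abs_pos.2 (h0 j)))
  obtain ⟨ε, hε, hε1, hε'⟩ := exists_pos_le_one_mul_le (fun j => |τ ⬝ᵥ r j|)
    (fun j => if 0 < σ ⬝ᵥ r j then η * (σ ⬝ᵥ r j - |τ ⬝ᵥ r j|) else (1 + c) * |σ ⬝ᵥ r j|)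
    (fun j => by
      split_ifs with h
      · exact mul_pos hη (sub_pos.2 (hτ j h))
      · exact mul_pos (by linarith) (abs_pos.2 (h0 j)))
  have hσ' : ∀ x ∈ intPoints, c * (σ ⬝ᵥ (x - f)) ≤ -1 ∨
      (σ ⬝ᵥ (x - f) = 1 ∧ ∃ n : ℤ, (-τ) ⬝ᵥ (x - f) = n) ∨ 2 ≤ σ ⬝ᵥ (x - f) := by
    intro x hx
    rcases hσ x hx with h | ⟨h, n, hn⟩ | h
    · exact Or.inl h
    · exact Or.inr (Or.inl ⟨h, -n, by rw [neg_dotProduct, hn]; push_cast; rfl⟩)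
    · exact Or.inr (Or.inr h)
  have pos : ∀ τ' : Fin 2 → ℝ, (∀ j, |τ' ⬝ᵥ r j| = |τ ⬝ᵥ r j|) → ∀ j, 0 < σ ⬝ᵥ r j →
      psi (tilt σ τ' c ε η) (r j) = σ ⬝ᵥ r j - ε * (τ' ⬝ᵥ r j) := by
    intro τ' h j hj
    have hle := le_abs_self (τ' ⬝ᵥ r j)
    rw [h] at hle
    have h3 := hε' j
    simp only [hj, if_true] at h3
    refine psi_tilt_of_pos hc hε1 hε hj (hle.trans_lt (hτ j hj)) ?_
    nlinarith
  have neg : ∀ τ' : Fin 2 → ℝ, (∀ j, |τ' ⬝ᵥ r j| = |τ ⬝ᵥ r j|) → ∀ j, σ ⬝ᵥ r j < 0 →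
      psi (tilt σ τ' c ε η) (r j) = -(c * (σ ⬝ᵥ r j)) := by
    intro τ' h j hj
    have h3 := hε' j
    simp only [hj.not_gt, if_false] at h3
    exact psi_tilt_of_neg (by rw [h]; exact h3) hε hη hj (by rw [h]; exact hη' j)
  have habs : ∀ j, |(-τ) ⬝ᵥ r j| = |τ ⬝ᵥ r j| := fun j => by rw [neg_dotProduct, abs_neg]
  refine ⟨gam r (tilt σ τ c ε η), ⟨_, isLatticeFree_tilt hσ hε hε1 hη hη1, rfl⟩,
    gam r (tilt σ (-τ) c ε η), ⟨_, isLatticeFree_tilt hσ' hε hε1 hη hη1, rfl⟩, ?_, ?_⟩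
  · obtain ⟨j, hj, hj'⟩ := hne
    intro h
    have := congrFun h j
    simp only [gam] at this
    rw [pos τ (fun _ => rfl) j hj, pos (-τ) habs j hj, neg_dotProduct] at this
    have : ε * (τ ⬝ᵥ r j) = 0 := by linarith
    rcases mul_eq_zero.1 this with h | h
    · exact hε.ne' h
    · exact hj' h
  · ext j
    simp only [Pi.smul_apply, Pi.add_apply, smul_eq_mul, gam]
    rw [hγ]
    rcases lt_or_gt_of_ne (h0 j) with hj | hj
    · rw [neg τ (fun _ => rfl) j hj, neg (-τ) habs j hj, max_eq_right]
      · ring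
      · nlinarith
    · rw [pos τ (fun _ => rfl) j hj, pos (-τ) habs j hj, neg_dotProduct, max_eq_left]
      · ring
      · nlinarith

/-! ### Splits outside `Ξ₀` are strict convex combinations -/

/-- The matrix of a split in which the facet with normal `σ` comes first. -/
def splitMatrix (σ : Fin 2 → ℝ) (c : ℝ) : Matrix (Fin 3) (Fin 2) ℝ := ![σ, -(c • σ), σ]

lemma M_splitMatrix (f : Fin 2 → ℝ) {π : Fin 2 → ℤ} (hf : Int.fract (intVec π ⬝ᵥ f) ≠ 0) :
    M f (splitMatrix ((1 - Int.fract (intVec π ⬝ᵥ f))⁻¹ • intVec π)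
      ((1 - Int.fract (intVec π ⬝ᵥ f)) / Int.fract (intVec π ⬝ᵥ f))) =
      strip π ⌊intVec π ⬝ᵥ f⌋ := by
  have h0 : 0 < Int.fract (intVec π ⬝ᵥ f) := lt_of_le_of_ne (Int.fract_nonneg _) hf.symm
  have h1 : 0 < 1 - Int.fract (intVec π ⬝ᵥ f) := by linarith [Int.fract_lt_one (intVec π ⬝ᵥ f)]
  have h2 := Int.self_sub_floor (intVec π ⬝ᵥ f)
  ext x
  rw [splitMatrix, mem_M_cons]
  simp only [strip, Set.mem_ofPred_eq, neg_dotProduct, smul_dotProduct, smul_eq_mul]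
  have e : ∀ y : ℝ, (1 - Int.fract (intVec π ⬝ᵥ f)) / Int.fract (intVec π ⬝ᵥ f) *
      ((1 - Int.fract (intVec π ⬝ᵥ f))⁻¹ * y) = y / Int.fract (intVec π ⬝ᵥ f) := by
    intro y; field_simp
  rw [e, inv_mul_le_iff₀ h1, ← neg_div, div_le_iff₀ h0, dotProduct_sub]
  constructor
  · rintro ⟨a, b, -⟩; constructor <;> linarith
  · rintro ⟨a, b⟩; refine ⟨?_, ?_, ?_⟩ <;> linarith

lemma eq_of_dot_eq {π : Fin 2 → ℤ} {u v : ℤ} (huv : u * π 0 + v * π 1 = 1) {x y : Fin 2 → ℝ}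
    (h1 : intVec π ⬝ᵥ x = intVec π ⬝ᵥ y)
    (h2 : intVec ![-v, u] ⬝ᵥ x = intVec ![-v, u] ⬝ᵥ y) : x = y := by
  have e : (u : ℝ) * π 0 + v * π 1 = 1 := by exact_mod_cast huv
  rw [dot_eq, dot_eq] at h1 h2
  simp only [intVec, cons_val_zero, cons_val_one] at h1 h2
  push_cast at h1 h2
  ext i
  fin_cases i
  · change x 0 = y 0
    linear_combination (u : ℝ) * h1 - (π 1 : ℝ) * h2 - (x 0 - y 0) * e
  · change x 1 = y 1
    linear_combination (v : ℝ) * h1 + (π 0 : ℝ) * h2 - (x 1 - y 1) * e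

lemma exists_intVec_dot_eq {π : Fin 2 → ℤ} {u v : ℤ} (huv : u * π 0 + v * π 1 = 1) (a n : ℤ) :
    ∃ z : Fin 2 → ℤ, intVec π ⬝ᵥ intVec z = a ∧ intVec ![-v, u] ⬝ᵥ intVec z = n := by
  refine ⟨![a * u - n * π 1, a * v + n * π 0], ?_, ?_⟩
  · rw [intVec_dot]
    simp only [cons_val_zero, cons_val_one]
    congr 1
    linear_combination a * huv
  · rw [intVec_dot]
    simp only [cons_val_zero, cons_val_one]
    congr 1
    linear_combination n * huv

/-- Case c is excluded for every matrix of the same split, because the facet met by the ray `j₀`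
need not come from row `0` of `B`; `splitMatrix` puts it there. -/
lemma exists_strictConvexComb_of_not_mem {k : ℕ} {f : Fin 2 → ℝ} {r : Fin k → Fin 2 → ℝ}
    {π : Fin 2 → ℤ} {B : Matrix (Fin 3) (Fin 2) ℝ} (hπ : IsCoprime (π 0) (π 1))
    (hf : Int.fract (intVec π ⬝ᵥ f) ≠ 0) (hM : M f B = strip π ⌊intVec π ⬝ᵥ f⌋)
    (hr : ∀ j, intVec π ⬝ᵥ r j ≠ 0)
    (hC : ∀ B', M f B' = M f B → ¬ CaseC f r B') {j₀ : Fin k} (hj₀ : 0 < intVec π ⬝ᵥ r j₀)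
    (hint : f + (1 / psi B (r j₀)) • r j₀ ∉ intPoints) :
    ∃ γ₁ ∈ Delta f r, ∃ γ₂ ∈ Delta f r, IsStrictConvexComb (gam r B) γ₁ γ₂ := by
  have hφ : 0 < Int.fract (intVec π ⬝ᵥ f) := lt_of_le_of_ne (Int.fract_nonneg _) hf.symm
  have hα : 0 < 1 - Int.fract (intVec π ⬝ᵥ f) := by
    linarith [Int.fract_lt_one (intVec π ⬝ᵥ f)]
  have hfl := Int.self_sub_floor (intVec π ⬝ᵥ f)
  have hM' := (M_splitMatrix f hf).trans hM.symm
  have hpsi := psi_eq_splitGauge hf hM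
  have hpsi' := psi_eq_splitGauge hf (M_splitMatrix f hf)
  set φ := Int.fract (intVec π ⬝ᵥ f) with hφdef
  set α := 1 - φ with hαdef
  set σ : Fin 2 → ℝ := α⁻¹ • intVec π with hσdef
  set c := α / φ with hcdef
  have hc : 0 < c := div_pos hα hφ
  have hσ : ∀ x, σ ⬝ᵥ x = (intVec π ⬝ᵥ x) / α := by
    intro x; rw [hσdef, smul_dotProduct, smul_eq_mul, inv_mul_eq_div]
  have hcσ : ∀ x, c * (σ ⬝ᵥ x) = (intVec π ⬝ᵥ x) / φ := by
    intro x; rw [hσ, hcdef]; field_simp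
  have hgauge : ∀ x, splitGauge f π x = max (σ ⬝ᵥ x) (-(c * (σ ⬝ᵥ x))) := by
    intro x
    rw [hcσ, hσ, splitGauge, neg_div]
  have hgpos : ∀ x, 0 < σ ⬝ᵥ x → splitGauge f π x = σ ⬝ᵥ x := by
    intro x hx
    rw [hgauge, max_eq_left]
    nlinarith [mul_pos hc hx]
  have hs₀ : 0 < σ ⬝ᵥ r j₀ := by rw [hσ]; exact div_pos hj₀ hα
  -- The Bézout coefficients complete `π` to a unimodular pair, so `τ₀ = (-v, u)` is an integral
  -- coordinate along the facet.
  obtain ⟨u, v, huv⟩ := hπ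
  set τ₀ : Fin 2 → ℝ := intVec ![-v, u] with hτ₀
  set p : Fin k → Fin 2 → ℝ := fun j => f + (1 / (σ ⬝ᵥ r j)) • r j with hp
  have hσp : ∀ j, 0 < σ ⬝ᵥ r j → σ ⬝ᵥ (p j - f) = 1 := by
    intro j hj
    rw [hp]
    simp only [add_sub_cancel_left, dotProduct_smul, smul_eq_mul]
    exact one_div_mul_cancel hj.ne'
  have hπp : ∀ j, 0 < σ ⬝ᵥ r j → intVec π ⬝ᵥ p j = ((⌊intVec π ⬝ᵥ f⌋ + 1 : ℤ) : ℝ) := by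
    intro j hj
    have := hσp j hj
    rw [hσ, div_eq_one_iff_eq hα.ne', dotProduct_sub] at this
    push_cast
    linarith
  have hτp : ∀ j, 0 < σ ⬝ᵥ r j → τ₀ ⬝ᵥ r j = (σ ⬝ᵥ r j) * (τ₀ ⬝ᵥ p j - τ₀ ⬝ᵥ f) := by
    intro j hj
    rw [hp]
    simp only [dotProduct_add, dotProduct_smul, smul_eq_mul]
    field_simp
    ring
  have hpF : ∀ j, 0 < σ ⬝ᵥ r j →
      p j ∈ rayIntersections f (splitMatrix σ c) (Set.range r) ∩ F f (splitMatrix σ c) 0 := by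
    intro j hj
    have e : psi (splitMatrix σ c) (r j) = σ ⬝ᵥ r j := by rw [hpsi', hgpos _ hj]
    refine ⟨⟨r j, ⟨j, rfl⟩, by rw [e]; exact hj, by rw [e]⟩, ?_, hσp j hj⟩
    rw [hp, add_smul_mem_M_iff f _ _ (one_div_pos.2 hj), e]
    exact (one_div_mul_cancel hj.ne').le
  set J := Finset.univ.filter fun j => 0 < σ ⬝ᵥ r j with hJ
  have hJne : J.Nonempty := ⟨j₀, Finset.mem_filter.2 ⟨Finset.mem_univ _, hs₀⟩⟩
  obtain ⟨j₁, hj₁, hmax⟩ := J.exists_max_image (fun j => τ₀ ⬝ᵥ p j) hJne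
  obtain ⟨j₂, hj₂, hmin⟩ := J.exists_min_image (fun j => τ₀ ⬝ᵥ p j) hJne
  have hj₁' : 0 < σ ⬝ᵥ r j₁ := (Finset.mem_filter.1 hj₁).2
  have hj₂' : 0 < σ ⬝ᵥ r j₂ := (Finset.mem_filter.1 hj₂).2
  -- The pivot is the last integer coordinate not beyond the ray intersections.
  set n := ⌊τ₀ ⬝ᵥ p j₁⌋ with hn
  have hn1 : (n : ℝ) ≤ τ₀ ⬝ᵥ p j₁ := Int.floor_le _
  have hn2 : τ₀ ⬝ᵥ p j₁ < n + 1 := Int.lt_floor_add_one _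
  -- Otherwise the integer points with coordinates `n - 1` and `n` both lie between extreme
  -- intersections, which is Case c.
  have hlow : (n : ℝ) - 1 < τ₀ ⬝ᵥ p j₂ := by
    by_contra hcon
    push Not at hcon
    refine hC _ hM' ?_
    have key : ∀ m : ℤ, n - 1 ≤ m → m ≤ n → ∀ z : Fin 2 → ℤ,
        intVec π ⬝ᵥ intVec z = ((⌊intVec π ⬝ᵥ f⌋ + 1 : ℤ) : ℝ) → τ₀ ⬝ᵥ intVec z = m →
        intVec z ∈ convexHull ℝ (rayIntersections f (splitMatrix σ c) (Set.range r) ∩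
          F f (splitMatrix σ c) 0) ∩ intPoints := by
      intro m hm1 hm2 z hz1 hz2
      refine ⟨?_, intVec_mem z⟩
      have hm1' : (n : ℝ) - 1 ≤ m := by exact_mod_cast hm1
      have hm2' : (m : ℝ) ≤ n := by exact_mod_cast hm2
      have hd : 0 < τ₀ ⬝ᵥ p j₁ - τ₀ ⬝ᵥ p j₂ := by linarith
      set θ := (m - τ₀ ⬝ᵥ p j₂) / (τ₀ ⬝ᵥ p j₁ - τ₀ ⬝ᵥ p j₂) with hθ
      have hθ0 : 0 ≤ θ := div_nonneg (by linarith) hd.le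
      have hθ1 : θ ≤ 1 := by rw [hθ, div_le_one hd]; linarith
      have e : intVec z = (1 - θ) • p j₂ + θ • p j₁ := by
        apply eq_of_dot_eq huv
        · rw [dotProduct_add, dotProduct_smul, dotProduct_smul, hπp _ hj₁', hπp _ hj₂', hz1]
          simp only [smul_eq_mul]; ring
        · rw [← hτ₀, dotProduct_add, dotProduct_smul, dotProduct_smul, hz2]
          simp only [smul_eq_mul]
          have : θ * (τ₀ ⬝ᵥ p j₁ - τ₀ ⬝ᵥ p j₂) = m - τ₀ ⬝ᵥ p j₂ := div_mul_cancel₀ _ hd.ne'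
          linarith
      rw [e]
      exact convex_convexHull ℝ _ (subset_convexHull ℝ _ (hpF _ hj₂'))
        (subset_convexHull ℝ _ (hpF _ hj₁')) (by linarith) hθ0 (by ring)
    obtain ⟨z, hz1, hz2⟩ := exists_intVec_dot_eq huv (⌊intVec π ⬝ᵥ f⌋ + 1) n
    obtain ⟨z', hz1', hz2'⟩ := exists_intVec_dot_eq huv (⌊intVec π ⬝ᵥ f⌋ + 1) (n - 1)
    have hne : intVec z ≠ intVec z' := by
      intro h
      rw [h, hz2'] at hz2
      have : n - 1 = n := by exact_mod_cast hz2
      omega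
    rw [CaseC, ← Set.encard_pair hne]
    refine Set.encard_le_encard ?_
    rintro x (rfl | rfl)
    · exact key n (by omega) le_rfl z hz1 hz2
    · exact key (n - 1) le_rfl (by omega) z' hz1' hz2'
  -- The correction by `σ` makes `τ · (x - f)` equal to `τ₀ · x - n` on the facet: it vanishes at
  -- the pivot and stays integral at integer points.
  set τ : Fin 2 → ℝ := τ₀ - (n - τ₀ ⬝ᵥ f) • σ with hτ
  have hτx : ∀ x, τ ⬝ᵥ x = τ₀ ⬝ᵥ x - (n - τ₀ ⬝ᵥ f) * (σ ⬝ᵥ x) := by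
    intro x
    rw [hτ, sub_dotProduct, smul_dotProduct, smul_eq_mul]
  have hτr : ∀ j, 0 < σ ⬝ᵥ r j → τ ⬝ᵥ r j = (σ ⬝ᵥ r j) * (τ₀ ⬝ᵥ p j - n) := by
    intro j hj
    rw [hτx, hτp j hj]
    ring
  refine exists_strictConvexComb_of_tilt (σ := σ) (τ := τ) hc ?_ ?_ ?_ ?_ ⟨j₀, hs₀, ?_⟩
  · intro x hx
    obtain ⟨z, rfl⟩ := exists_intVec_of_mem hx
    have hz := intVec_dot π z
    set w := π 0 * z 0 + π 1 * z 1 with hw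
    rcases lt_trichotomy w (⌊intVec π ⬝ᵥ f⌋ + 1) with h | h | h
    · left
      have : (w : ℝ) ≤ ⌊intVec π ⬝ᵥ f⌋ := by exact_mod_cast Int.lt_add_one_iff.1 h
      rw [hcσ, div_le_iff₀ hφ, dotProduct_sub, hz]
      linarith
    · right; left
      have e : σ ⬝ᵥ (intVec z - f) = 1 := by
        rw [hσ, div_eq_one_iff_eq hα.ne', dotProduct_sub, hz, h]
        push_cast
        linarith
      refine ⟨e, (![-v, u] : Fin 2 → ℤ) 0 * z 0 + (![-v, u] : Fin 2 → ℤ) 1 * z 1 - n, ?_⟩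
      rw [hτx, e, dotProduct_sub, hτ₀, intVec_dot]
      push_cast
      ring
    -- The next lattice line has `σ`-value at least `(1 + α) / α`, which is at least `2` because `α
    -- ≤ 1`.
    · right; right
      have : (⌊intVec π ⬝ᵥ f⌋ : ℝ) + 1 + 1 ≤ w := by exact_mod_cast h
      rw [hσ, le_div_iff₀ hα, dotProduct_sub, hz]
      linarith
  · intro j
    rw [gam, hpsi, hgauge]
  · intro j
    rw [hσ]
    exact div_ne_zero (hr j) hα.ne'
  · intro j hj
    have hjJ : j ∈ J := Finset.mem_filter.2 ⟨Finset.mem_univ _, hj⟩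
    have a := hmax j hjJ
    have b := hmin j hjJ
    rw [hτr j hj, abs_mul, abs_of_pos hj]
    have : |τ₀ ⬝ᵥ p j - n| < 1 := abs_lt.2 ⟨by linarith, by linarith⟩
    nlinarith
  · rw [hτr _ hs₀]
    refine mul_ne_zero hs₀.ne' fun h => hint ?_
    obtain ⟨z, hz1, hz2⟩ := exists_intVec_dot_eq huv (⌊intVec π ⬝ᵥ f⌋ + 1) n
    rw [hpsi, hgpos _ hs₀]
    have : p j₀ = intVec z := by
      apply eq_of_dot_eq huv
      · rw [hπp _ hs₀, hz1]
      · rw [hz2]; linarith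
    exact (congrArg (· ∈ intPoints) this).mpr (intVec_mem z)

lemma exists_strictConvexComb {k : ℕ} {f : Fin 2 → ℝ} {r : Fin k → Fin 2 → ℝ} {γ : Fin k → ℝ}
    (hγ : γ ∈ splitVectors f r) (hγ' : γ ∉ Xi0 f r) :
    ∃ γ₁ ∈ Delta f r, ∃ γ₂ ∈ Delta f r, IsStrictConvexComb γ γ₁ γ₂ := by
  obtain ⟨B, hB, rfl⟩ := hγ
  obtain ⟨π, hπ, hf, hM, hpsi⟩ := hB.exists_coprime
  have hA : ¬ CaseA f r B := fun h => hγ' ⟨B, hB, Or.inl h, rfl⟩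
  have hb : ¬ CaseB f r B := fun h => hγ' ⟨B, hB, Or.inr (Or.inl h), rfl⟩
  have hr : ∀ j, intVec π ⬝ᵥ r j ≠ 0 := by
    intro j hj
    refine hb ⟨j, ?_⟩
    rw [hM]
    intro x hx t _
    simp only [strip, Set.mem_ofPred_eq, dotProduct_add, dotProduct_smul, hj, smul_zero,
      add_zero]
    exact hx
  have hC : ∀ B', M f B' = M f B → ¬ CaseC f r B' := by
    intro B' h hC
    refine hγ' ⟨B', ?_, Or.inr (Or.inr hC), ?_⟩
    · rw [IsMaximalSplit, h]; exact hB
    · ext j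
      rw [gam, gam, hpsi, psi_eq_splitGauge hf (h.trans hM)]
  simp only [CaseA, rayIntersections, Set.not_subset] at hA
  obtain ⟨_, ⟨_, ⟨j₀, rfl⟩, -, rfl⟩, hj₀⟩ := hA
  -- Replacing `π` by `-π` if necessary, the nonintegral ray meets the upper facet.
  rcases lt_or_gt_of_ne (hr j₀) with h | h
  · refine exists_strictConvexComb_of_not_mem (π := -π) ?_ (fract_neg_ne hf)
      (by rw [strip_neg hf, hM]) ?_ hC (j₀ := j₀) ?_ hj₀
    · exact hπ.neg_neg
    · intro j; rw [intVec_neg, neg_dotProduct]; exact neg_ne_zero.2 (hr j)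
    · rw [intVec_neg, neg_dotProduct]; linarith
  · exact exists_strictConvexComb_of_not_mem hπ hf hM hr hC h hj₀

/-! ### Corners of a planar cone and their labels -/

/-- The determinant of two integer vectors in the plane. -/
def idet (u v : Fin 2 → ℤ) : ℤ := u 0 * v 1 - u 1 * v 0

/-- The inner product of two integer vectors in the plane. -/
def idot (u v : Fin 2 → ℤ) : ℤ := u 0 * v 0 + u 1 * v 1

/-- The integer point `x` lies in the cone with apex `F / q` spanned by `a` and `b`,
for `0 < idet a b`. -/
def InCone (q : ℤ) (F a b x : Fin 2 → ℤ) : Prop :=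
  0 ≤ idet (q • x - F) b ∧ 0 ≤ idet a (q • x - F)

/-- The integer point `x` of the cone is not a proper midpoint of integer points of the cone on
the line through `x` with normal `π`. -/
def IsCorner (q : ℤ) (F a b π x : Fin 2 → ℤ) : Prop :=
  InCone q F a b x ∧
    ∀ v, idot π v = 0 → InCone q F a b (x + v) → InCone q F a b (x - v) → v = 0

/-- The numbers of binary digits of the two cone coordinates of `x`. -/
def coneLabel (q : ℤ) (F a b x : Fin 2 → ℤ) : ℕ × ℕ :=
  (Nat.size (idet (q • x - F) b).toNat, Nat.size (idet a (q • x - F)).toNat)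

lemma idot_add (π x y : Fin 2 → ℤ) : idot π (x + y) = idot π x + idot π y := by
  simp only [idot, Pi.add_apply]; ring

lemma idot_sub (π x y : Fin 2 → ℤ) : idot π (x - y) = idot π x - idot π y := by
  simp only [idot, Pi.sub_apply]; ring

lemma eq_zero_of_idet_idot {π b v : Fin 2 → ℤ} (hb : 0 < idot π b) (h1 : idet v b = 0)
    (h2 : idot π v = 0) : v = 0 := by
  simp only [idot, idet] at *
  have e0 : (π 0 * b 0 + π 1 * b 1) * v 0 = 0 := by
    linear_combination b 0 * h2 + π 1 * h1
  have e1 : (π 0 * b 0 + π 1 * b 1) * v 1 = 0 := by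
    linear_combination b 1 * h2 - π 0 * h1
  ext i
  fin_cases i
  · exact (mul_eq_zero.1 e0).resolve_left hb.ne'
  · exact (mul_eq_zero.1 e1).resolve_left hb.ne'

section cone

variable {q c : ℤ} {F a b π : Fin 2 → ℤ}

lemma InCone.le_idot (hq : 0 < q) (hD : 0 < idet a b) (ha : 0 < idot π a) (hb : 0 < idot π b)
    (hc : q * (c - 1) < idot π F) {x : Fin 2 → ℤ} (hx : InCone q F a b x) : c ≤ idot π x := by
  -- This is Cramer's rule for `q x - F` in the basis `a`, `b`, paired with `π`.
  have e : idet a b * (q * idot π x - idot π F) =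
      idet (q • x - F) b * idot π a + idet a (q • x - F) * idot π b := by
    simp only [idot, idet, Pi.sub_apply, Pi.smul_apply, smul_eq_mul]; ring
  have h : 0 ≤ idet a b * (q * idot π x - idot π F) := by
    rw [e]
    exact add_nonneg (mul_nonneg hx.1 ha.le) (mul_nonneg hx.2 hb.le)
  have h1 := nonneg_of_mul_nonneg_right h hD
  have h2 : q * (c - 1) < q * idot π x := by linarith
  have h3 := lt_of_mul_lt_mul_left h2 hq.le
  omega

/-- If a cone coordinate were larger, subtracting `a` or `b` would stay in the cone and lower `π`,
while `c` is already the least level possible for integer points of the cone. -/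
lemma InCone.idet_lt (hq : 0 < q) (hD : 0 < idet a b) (ha : 0 < idot π a) (hb : 0 < idot π b)
    (hc : q * (c - 1) < idot π F) {x : Fin 2 → ℤ} (hx : InCone q F a b x) (hxc : idot π x = c) :
    idet (q • x - F) b < q * idet a b ∧ idet a (q • x - F) < q * idet a b := by
  constructor
  · by_contra h
    push Not at h
    have h1 : InCone q F a b (x - a) := by
      constructor
      · have : idet (q • (x - a) - F) b = idet (q • x - F) b - q * idet a b := by
          simp only [idet, Pi.sub_apply, Pi.smul_apply, smul_eq_mul]; ring
        linarith
      · have : idet a (q • (x - a) - F) = idet a (q • x - F) := by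
          simp only [idet, Pi.sub_apply, Pi.smul_apply, smul_eq_mul]; ring
        exact this ▸ hx.2
    have h2 := h1.le_idot hq hD ha hb hc
    rw [idot_sub] at h2
    linarith
  · by_contra h
    push Not at h
    have h1 : InCone q F a b (x - b) := by
      constructor
      · have : idet (q • (x - b) - F) b = idet (q • x - F) b := by
          simp only [idet, Pi.sub_apply, Pi.smul_apply, smul_eq_mul]; ring
        exact this ▸ hx.1
      · have : idet a (q • (x - b) - F) = idet a (q • x - F) - q * idet a b := by
          simp only [idet, Pi.sub_apply, Pi.smul_apply, smul_eq_mul]; ring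
        linarith
    have h2 := h1.le_idot hq hD ha hb hc
    rw [idot_sub] at h2
    linarith

lemma isCorner_of_minimal_left (hq : 0 < q) (hb : 0 < idot π b) {x : Fin 2 → ℤ}
    (hx : InCone q F a b x) (hmin : ∀ y, InCone q F a b y → idot π y = idot π x →
      idet (q • x - F) b ≤ idet (q • y - F) b) : IsCorner q F a b π x := by
  refine ⟨hx, fun v hv h1 h2 => ?_⟩
  have m1 := hmin _ h1 (by rw [idot_add, hv, add_zero])
  have m2 := hmin _ h2 (by rw [idot_sub, hv, sub_zero])
  have e1 : idet (q • (x + v) - F) b = idet (q • x - F) b + q * idet v b := by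
    simp only [idet, Pi.sub_apply, Pi.add_apply, Pi.smul_apply, smul_eq_mul]; ring
  have e2 : idet (q • (x - v) - F) b = idet (q • x - F) b - q * idet v b := by
    simp only [idet, Pi.sub_apply, Pi.smul_apply, smul_eq_mul]; ring
  have h0 : q * idet v b = 0 := by linarith
  exact eq_zero_of_idet_idot hb ((mul_eq_zero.1 h0).resolve_left hq.ne') hv

lemma isCorner_of_minimal_right (hq : 0 < q) (ha : 0 < idot π a) {x : Fin 2 → ℤ}
    (hx : InCone q F a b x) (hmin : ∀ y, InCone q F a b y → idot π y = idot π x →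
      idet a (q • x - F) ≤ idet a (q • y - F)) : IsCorner q F a b π x := by
  refine ⟨hx, fun v hv h1 h2 => ?_⟩
  have m1 := hmin _ h1 (by rw [idot_add, hv, add_zero])
  have m2 := hmin _ h2 (by rw [idot_sub, hv, sub_zero])
  have e1 : idet a (q • (x + v) - F) = idet a (q • x - F) - q * idet v a := by
    simp only [idet, Pi.sub_apply, Pi.add_apply, Pi.smul_apply, smul_eq_mul]; ring
  have e2 : idet a (q • (x - v) - F) = idet a (q • x - F) + q * idet v a := by
    simp only [idet, Pi.sub_apply, Pi.smul_apply, smul_eq_mul]; ring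
  have h0 : q * idet v a = 0 := by linarith
  exact eq_zero_of_idet_idot ha ((mul_eq_zero.1 h0).resolve_left hq.ne') hv

/-- The two ends of the set of integer points on the line inside the cone are corners: each
minimizes one cone coordinate. If the ends coincided, Cramer's rule would leave a single point. -/
lemma exists_isCorner_ne (hq : 0 < q) (ha : 0 < idot π a)
    (hb : 0 < idot π b) {x y : Fin 2 → ℤ} (hx : InCone q F a b x) (hy : InCone q F a b y)
    (hxc : idot π x = c) (hyc : idot π y = c) (hxy : x ≠ y) :
    ∃ x' y', x' ≠ y' ∧ IsCorner q F a b π x' ∧ IsCorner q F a b π y' ∧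
      idot π x' = c ∧ idot π y' = c := by
  set S : Set (Fin 2 → ℤ) := {z | InCone q F a b z ∧ idot π z = c} with hS
  have hne : S.Nonempty := ⟨x, hx, hxc⟩
  have min : ∀ g : (Fin 2 → ℤ) → ℤ, (∀ z ∈ S, 0 ≤ g z) → ∃ z ∈ S, ∀ w ∈ S, g z ≤ g w := by
    intro g hg
    obtain ⟨z, hz, hmin⟩ := exists_minimalFor_of_wellFoundedLT (· ∈ S) (fun z => (g z).toNat) hne
    refine ⟨z, hz, fun w hw => ?_⟩
    have := hmin hw
    have h1 := hg z hz
    have h2 := hg w hw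
    dsimp only at this
    omega
  obtain ⟨x', hx', mx⟩ := min (fun z => idet (q • z - F) b) fun z hz => hz.1.1
  obtain ⟨y', hy', my⟩ := min (fun z => idet a (q • z - F)) fun z hz => hz.1.2
  refine ⟨x', y', ?_, isCorner_of_minimal_left hq hb hx'.1 fun z hz hz' =>
    mx z ⟨hz, hz'.trans hx'.2⟩, isCorner_of_minimal_right hq ha hy'.1 fun z hz hz' =>
    my z ⟨hz, hz'.trans hy'.2⟩, hx'.2, hy'.2⟩
  rintro rfl
  have all : ∀ z ∈ S, z = x' := by
    intro z hz
    have h1 := mx z hz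
    have h2 := my z hz
    have h3 : idot π (z - x') = 0 := by rw [idot_sub, hz.2, hx'.2, sub_self]
    have e1 : idet (q • z - F) b - idet (q • x' - F) b = q * idet (z - x') b := by
      simp only [idet, Pi.sub_apply, Pi.smul_apply, smul_eq_mul]; ring
    have e2 : idet a (q • z - F) - idet a (q • x' - F) = q * idet a (z - x') := by
      simp only [idet, Pi.sub_apply, Pi.smul_apply, smul_eq_mul]; ring
    have g1 : 0 ≤ idet (z - x') b := nonneg_of_mul_nonneg_right (by linarith) hq
    have g2 : 0 ≤ idet a (z - x') := nonneg_of_mul_nonneg_right (by linarith) hq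
    have e3 : idet a b * idot π (z - x') =
        idet (z - x') b * idot π a + idet a (z - x') * idot π b := by
      simp only [idot, idet]; ring
    rw [h3, mul_zero] at e3
    have k1 := mul_nonneg g1 ha.le
    have k2 := mul_nonneg g2 hb.le
    have k3 : idet (z - x') b * idot π a = 0 := by linarith
    have h4 : idet (z - x') b = 0 := (mul_eq_zero.1 k3).resolve_right ha.ne'
    exact sub_eq_zero.1 (eq_zero_of_idet_idot hb h4 h3)
  exact hxy ((all x ⟨hx, hxc⟩).trans (all y ⟨hy, hyc⟩).symm)

lemma le_two_mul_of_size_eq {m n : ℕ} (h : Nat.size m = Nat.size n) : n ≤ 2 * m := by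
  rcases Nat.eq_zero_or_pos (Nat.size n) with h0 | h0
  · have : n = 0 := Nat.size_eq_zero.1 h0
    omega
  · have h1 : n < 2 ^ Nat.size n := Nat.lt_size_self n
    have h2 : 2 ^ (Nat.size n - 1) ≤ m := Nat.lt_size.1 (by omega)
    have h3 : 2 ^ Nat.size n = 2 * 2 ^ (Nat.size n - 1) := by
      rw [← pow_succ']; congr 1; omega
    omega

/-- Numbers of equal binary length differ by a factor of at most two, so the reflection `2x - y`
stays in the cone. As `c` is the least level, `y` and `2x - y` both lie on it, and the corner
property gives `y = x`. Since `y` need only be in the cone, corners for different normals can be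
compared. -/
lemma IsCorner.eq_of_label_eq (hq : 0 < q) (hD : 0 < idet a b) (ha : 0 < idot π a)
    (hb : 0 < idot π b) (hc : q * (c - 1) < idot π F) {x y : Fin 2 → ℤ}
    (hx : IsCorner q F a b π x) (hxc : idot π x = c) (hy : InCone q F a b y)
    (h : coneLabel q F a b x = coneLabel q F a b y) : x = y := by
  simp only [coneLabel, Prod.mk.injEq] at h
  have l1 := le_two_mul_of_size_eq h.1
  have l2 := le_two_mul_of_size_eq h.2
  have hx1 := hx.1.1
  have hx2 := hx.1.2
  have hy1 := hy.1
  have hy2 := hy.2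
  have e1 : idet (q • (x - (y - x)) - F) b =
      2 * idet (q • x - F) b - idet (q • y - F) b := by
    simp only [idet, Pi.sub_apply, Pi.smul_apply, smul_eq_mul]; ring
  have e2 : idet a (q • (x - (y - x)) - F) =
      2 * idet a (q • x - F) - idet a (q • y - F) := by
    simp only [idet, Pi.sub_apply, Pi.smul_apply, smul_eq_mul]; ring
  have hm : InCone q F a b (x - (y - x)) := ⟨by omega, by omega⟩
  have g1 := hy.le_idot hq hD ha hb hc
  have g2 := hm.le_idot hq hD ha hb hc
  rw [idot_sub, idot_sub] at g2
  have h0 : idot π (y - x) = 0 := by rw [idot_sub]; linarith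
  exact (sub_eq_zero.1 (hx.2 (y - x) h0 (by rwa [add_sub_cancel]) hm)).symm

lemma InCone.label_lt (hq : 0 < q) (hD : 0 < idet a b) (ha : 0 < idot π a) (hb : 0 < idot π b)
    (hc : q * (c - 1) < idot π F) {x : Fin 2 → ℤ} (hx : InCone q F a b x) (hxc : idot π x = c)
    {m : ℕ} (hm : q * idet a b ≤ 2 ^ m) :
    (coneLabel q F a b x).1 < m + 1 ∧ (coneLabel q F a b x).2 < m + 1 := by
  obtain ⟨h1, h2⟩ := hx.idet_lt hq hD ha hb hc hxc
  have key : ∀ z : ℤ, 0 ≤ z → z < q * idet a b → Nat.size z.toNat < m + 1 := by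
    intro z hz0 hz
    refine Nat.lt_succ_of_le (Nat.size_le.2 ?_)
    zify
    rw [Int.toNat_of_nonneg hz0]
    linarith
  exact ⟨key _ hx.1 h1, key _ hx.2 h2⟩

end cone

/-! ### Clearing denominators and encoding sizes -/

/-- An integer multiple of a rational vector. -/
def clearDen (v : Fin 2 → ℚ) : Fin 2 → ℤ := ![(v 0).num * (v 1).den, (v 1).num * (v 0).den]

/-- The factor between `v` and `clearDen v`. -/
def scale (v : Fin 2 → ℚ) : ℤ := (v 0).den * (v 1).den

lemma scale_pos (v : Fin 2 → ℚ) : 0 < scale v :=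
  mul_pos (by exact_mod_cast (v 0).den_pos) (by exact_mod_cast (v 1).den_pos)

lemma clearDen_eq (v : Fin 2 → ℚ) (i : Fin 2) :
    (clearDen v i : ℝ) = scale v * toReal v i := by
  have h : ∀ x : ℚ, (x.num : ℝ) = x * x.den := fun x => by
    exact_mod_cast (Rat.mul_den_eq_num x).symm
  fin_cases i
  · simp [clearDen, scale, toReal, h]; ring
  · simp [clearDen, scale, toReal, h]; ring

lemma vecSize_eq (v : Fin 2 → ℚ) : vecSize v = 4 + Nat.size (v 0).num.natAbs +
    Nat.size (v 0).den + Nat.size (v 1).num.natAbs + Nat.size (v 1).den := by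
  simp only [vecSize, ratSize, Fin.sum_univ_two]; omega

lemma scale_le (v : Fin 2 → ℚ) : scale v ≤ 2 ^ vecSize v := by
  have h : (v 0).den * (v 1).den ≤ 2 ^ vecSize v := by
    refine (Nat.mul_le_mul (Nat.lt_size_self (v 0).den).le (Nat.lt_size_self (v 1).den).le).trans ?_
    rw [← pow_add]
    exact Nat.pow_le_pow_right two_pos (by rw [vecSize_eq]; omega)
  rw [scale]
  exact_mod_cast h

lemma abs_clearDen_le (v : Fin 2 → ℚ) (i : Fin 2) : |clearDen v i| ≤ 2 ^ vecSize v := by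
  rw [Int.abs_eq_natAbs]
  have h : (clearDen v i).natAbs ≤ 2 ^ vecSize v := by
    fin_cases i
    · change ((v 0).num * ((v 1).den : ℤ)).natAbs ≤ _
      rw [Int.natAbs_mul, Int.natAbs_natCast]
      refine (Nat.mul_le_mul (Nat.lt_size_self _).le (Nat.lt_size_self _).le).trans ?_
      rw [← pow_add]
      exact Nat.pow_le_pow_right two_pos (by rw [vecSize_eq]; omega)
    · change ((v 1).num * ((v 0).den : ℤ)).natAbs ≤ _
      rw [Int.natAbs_mul, Int.natAbs_natCast]
      refine (Nat.mul_le_mul (Nat.lt_size_self _).le (Nat.lt_size_self _).le).trans ?_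
      rw [← pow_add]
      exact Nat.pow_le_pow_right two_pos (by rw [vecSize_eq]; omega)
  exact_mod_cast h

lemma scale_mul_idet_le {N : ℕ} (f v w : Fin 2 → ℚ) (hf : vecSize f ≤ N) (hv : vecSize v ≤ N)
    (hw : vecSize w ≤ N) : scale f * idet (clearDen v) (clearDen w) ≤ 2 ^ (3 * N + 1) := by
  have mono : ∀ {n : ℕ}, n ≤ N → (2 : ℤ) ^ n ≤ 2 ^ N := fun h => pow_le_pow_right₀ (by norm_num) h
  have hvi := fun i => (abs_clearDen_le v i).trans (mono hv)
  have hwi := fun i => (abs_clearDen_le w i).trans (mono hw)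
  have hs := (scale_le f).trans (mono hf)
  have hp : (0 : ℤ) < 2 ^ N := by positivity
  have m : ∀ i j, |clearDen v i * clearDen w j| ≤ 2 ^ N * 2 ^ N := fun i j => by
    rw [abs_mul]
    exact mul_le_mul (hvi i) (hwi j) (abs_nonneg _) hp.le
  have h1 : idet (clearDen v) (clearDen w) ≤ 2 * (2 ^ N * 2 ^ N) := by
    have a := (abs_le.1 (m 0 1)).2
    have b := (abs_le.1 (m 1 0)).1
    rw [idet]; linarith
  calc scale f * idet (clearDen v) (clearDen w) ≤ scale f * (2 * (2 ^ N * 2 ^ N)) :=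
        mul_le_mul_of_nonneg_left h1 (scale_pos f).le
    _ ≤ 2 ^ N * (2 * (2 ^ N * 2 ^ N)) := mul_le_mul_of_nonneg_right hs (by positivity)
    _ = 2 ^ (3 * N + 1) := by ring

lemma vecSize_le_inputSize {k : ℕ} (f : Fin 2 → ℚ) (r : Fin k → Fin 2 → ℚ) (j : Fin k) :
    vecSize (r j) ≤ inputSize f r :=
  (Finset.single_le_sum (f := fun j => vecSize (r j)) (fun _ _ => Nat.zero_le _)
    (Finset.mem_univ j)).trans (Nat.le_add_left _ _)

lemma le_inputSize {k : ℕ} (f : Fin 2 → ℚ) (r : Fin k → Fin 2 → ℚ) : k ≤ inputSize f r := by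
  have h : ∑ _j : Fin k, 1 ≤ ∑ j, vecSize (r j) :=
    Finset.sum_le_sum fun j _ => by rw [vecSize]; omega
  simp only [Finset.sum_const, Finset.card_univ, Fintype.card_fin, smul_eq_mul, mul_one] at h
  exact h.trans (Nat.le_add_left _ _)

/-! ### Case c yields two integer points in a cone of two rays -/

/-- The determinant of two vectors in the plane. -/
def rdet (u v : Fin 2 → ℝ) : ℝ := u 0 * v 1 - u 1 * v 0

/-- Row `0` vanishes along the strip, so it is a multiple `l` of `π`, and the sign of `l` selects
the facet. If `l = 0`, then `F f B 0` is empty. -/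
lemma dot_eq_of_mem_F {f : Fin 2 → ℝ} {B : Matrix (Fin 3) (Fin 2) ℝ} {π : Fin 2 → ℤ}
    (hπ : IsCoprime (π 0) (π 1)) (hf : Int.fract (intVec π ⬝ᵥ f) ≠ 0)
    (hM : M f B = strip π ⌊intVec π ⬝ᵥ f⌋) :
    (∀ x ∈ F f B 0, intVec π ⬝ᵥ x = ⌊intVec π ⬝ᵥ f⌋ + 1) ∨
      ∀ x ∈ F f B 0, intVec π ⬝ᵥ x = ⌊intVec π ⬝ᵥ f⌋ := by
  have hψ := psi_eq_splitGauge hf hM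
  have hfl := Int.self_sub_floor (intVec π ⬝ᵥ f)
  have h0 : 0 ≤ Int.fract (intVec π ⬝ᵥ f) := Int.fract_nonneg _
  have h1 : 0 ≤ 1 - Int.fract (intVec π ⬝ᵥ f) := by
    linarith [Int.fract_lt_one (intVec π ⬝ᵥ f)]
  set φ := Int.fract (intVec π ⬝ᵥ f)
  obtain ⟨u, v, huv⟩ := hπ
  have huv' : (u : ℝ) * π 0 + v * π 1 = 1 := by exact_mod_cast huv
  set d : Fin 2 → ℝ := ![-(π 1 : ℝ), π 0] with hd
  have hπd : intVec π ⬝ᵥ d = 0 := by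
    rw [dot_eq, hd]; simp only [intVec, cons_val_zero, cons_val_one]; ring
  have b1 : B 0 ⬝ᵥ d ≤ 0 := by
    refine (row_le_psi B d 0).trans ?_
    rw [hψ, (splitGauge_eq_zero_iff hf d).2 hπd]
  have b2 : B 0 ⬝ᵥ (-d) ≤ 0 := by
    refine (row_le_psi B (-d) 0).trans ?_
    rw [hψ, (splitGauge_eq_zero_iff hf (-d)).2 (by rw [dotProduct_neg, hπd, neg_zero])]
  rw [dotProduct_neg] at b2
  have b3 : B 0 ⬝ᵥ d = 0 := by linarith
  rw [dot_eq, hd] at b3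
  simp only [cons_val_zero, cons_val_one] at b3
  set l : ℝ := u * B 0 0 + v * B 0 1 with hl
  have hB : ∀ z, B 0 ⬝ᵥ z = l * (intVec π ⬝ᵥ z) := by
    intro z
    rw [dot_eq, dot_eq, hl]
    simp only [intVec]
    linear_combination (u * z 1 - v * z 0) * b3 - (B 0 0 * z 0 + B 0 1 * z 1) * huv'
  have hw : intVec π ⬝ᵥ intVec ![u, v] = 1 := by
    rw [intVec_dot]
    simp only [cons_val_zero, cons_val_one]
    have : π 0 * u + π 1 * v = 1 := by linarith
    rw [this]; norm_num
  have hz : ∀ s : ℝ, -φ ≤ s → s ≤ 1 - φ → l * s ≤ 1 := by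
    intro s hs1 hs2
    have hm : f + s • intVec ![u, v] ∈ M f B := by
      rw [hM]
      simp only [strip, Set.mem_ofPred_eq, dotProduct_add, dotProduct_smul, hw, smul_eq_mul]
      constructor <;> linarith
    have := hm 0
    rwa [add_sub_cancel_left, hB, dotProduct_smul, hw, smul_eq_mul, mul_one] at this
  have hF : ∀ x ∈ F f B 0, l * (intVec π ⬝ᵥ (x - f)) = 1 ∧
      -φ ≤ intVec π ⬝ᵥ (x - f) ∧ intVec π ⬝ᵥ (x - f) ≤ 1 - φ := by
    intro x hx
    have h1 := hx.1
    have h2 : B 0 ⬝ᵥ (x - f) = 1 := hx.2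
    rw [hB] at h2
    rw [hM] at h1
    obtain ⟨h3, h4⟩ := h1
    rw [dotProduct_sub] at h2 ⊢
    exact ⟨h2, by linarith, by linarith⟩
  have hu := hz (1 - φ) (by linarith) le_rfl
  have hlow := hz (-φ) le_rfl (by linarith)
  rcases lt_or_ge 0 l with hl0 | hl0
  · left
    intro x hx
    obtain ⟨e, h3, h4⟩ := hF x hx
    have : 1 - φ ≤ intVec π ⬝ᵥ (x - f) := by
      by_contra hh
      push Not at hh
      nlinarith
    rw [dotProduct_sub] at *
    linarith
  · right
    intro x hx
    obtain ⟨e, h3, h4⟩ := hF x hx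
    have hl1 : l < 0 := by
      rcases hl0.eq_or_lt with h | h
      · rw [h, zero_mul] at e; linarith
      · exact h
    have : intVec π ⬝ᵥ (x - f) ≤ -φ := by
      by_contra hh
      push Not at hh
      nlinarith
    rw [dotProduct_sub] at *
    linarith

lemma IsMaximalSplit.exists_coprime_dot_eq {f : Fin 2 → ℝ}
    {B : Matrix (Fin 3) (Fin 2) ℝ} (h : IsMaximalSplit f B) :
    ∃ π : Fin 2 → ℤ, IsCoprime (π 0) (π 1) ∧ Int.fract (intVec π ⬝ᵥ f) ≠ 0 ∧
      (∀ r, psi B r = splitGauge f π r) ∧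
      ∀ x ∈ F f B 0, intVec π ⬝ᵥ x = ⌊intVec π ⬝ᵥ f⌋ + 1 := by
  obtain ⟨π, hπ, hf, hM, hψ⟩ := h.exists_coprime
  rcases dot_eq_of_mem_F hπ hf hM with h | h
  · exact ⟨π, hπ, hf, hψ, h⟩
  · refine ⟨-π, hπ.neg_neg, fract_neg_ne hf, fun r => by rw [splitGauge_neg hf, hψ], ?_⟩
    intro x hx
    rw [intVec_neg, neg_dotProduct, neg_dotProduct, floor_neg_of_fract_ne_zero hf, h x hx]
    ring

/-- If the hull of the ray intersections on the first facet contains two integer points, then two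
integer points of that facet lie in the cone spanned by two of the rays. -/
lemma CaseC.exists_cone {k : ℕ} {f : Fin 2 → ℝ} {r : Fin k → Fin 2 → ℝ}
    {B : Matrix (Fin 3) (Fin 2) ℝ} (hB : IsMaximalSplit f B) (hC : CaseC f r B) :
    ∃ π : Fin 2 → ℤ, IsCoprime (π 0) (π 1) ∧ Int.fract (intVec π ⬝ᵥ f) ≠ 0 ∧
      (∀ r, psi B r = splitGauge f π r) ∧ ∃ i j : Fin k, 0 < intVec π ⬝ᵥ r i ∧
      0 < intVec π ⬝ᵥ r j ∧ 0 < rdet (r i) (r j) ∧ ∃ x y : Fin 2 → ℤ, x ≠ y ∧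
      ∀ z, z = x ∨ z = y → intVec π ⬝ᵥ intVec z = ⌊intVec π ⬝ᵥ f⌋ + 1 ∧
        ∃ s t : ℝ, 0 ≤ s ∧ 0 ≤ t ∧ intVec z - f = s • r i + t • r j := by
  set S := rayIntersections f B (Set.range r) ∩ F f B 0 with hS
  have hlt : 1 < (convexHull ℝ S ∩ intPoints).encard :=
    lt_of_lt_of_le (by norm_num) (hC : 2 ≤ (convexHull ℝ S ∩ intPoints).encard)
  obtain ⟨_, _, ⟨hx, hxi⟩, ⟨hy, hyi⟩, hxy⟩ := Set.one_lt_encard_iff.1 hlt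
  obtain ⟨x, rfl⟩ := exists_intVec_of_mem hxi
  obtain ⟨y, rfl⟩ := exists_intVec_of_mem hyi
  have hSne : S.Nonempty := convexHull_nonempty_iff.1 ⟨_, hx⟩
  obtain ⟨π, hπ, hf, hψ, hF⟩ := hB.exists_coprime_dot_eq
  obtain ⟨u, v, huv⟩ := hπ
  have huv' : (u : ℝ) * π 0 + v * π 1 = 1 := by exact_mod_cast huv
  set τ : Fin 2 → ℝ := intVec ![-v, u] with hτ
  set p : Fin k → Fin 2 → ℝ := fun j => f + (1 / psi B (r j)) • r j with hp
  classical
  set J := Finset.univ.filter fun j => 0 < psi B (r j) ∧ p j ∈ F f B 0 with hJ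
  have hSJ : ∀ z ∈ S, ∃ j ∈ J, z = p j := by
    rintro _ ⟨⟨_, ⟨j, rfl⟩, hpos, rfl⟩, hm⟩
    exact ⟨j, Finset.mem_filter.2 ⟨Finset.mem_univ _, hpos, hm⟩, rfl⟩
  have hJne : J.Nonempty := by
    obtain ⟨z, hz⟩ := hSne
    obtain ⟨j, hj, -⟩ := hSJ z hz
    exact ⟨j, hj⟩
  obtain ⟨j, hj, hmax⟩ := J.exists_max_image (fun j => τ ⬝ᵥ p j) hJne
  obtain ⟨i, hi, hmin⟩ := J.exists_min_image (fun j => τ ⬝ᵥ p j) hJne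
  obtain ⟨-, hψi, hpi⟩ := Finset.mem_filter.1 hi
  obtain ⟨-, hψj, hpj⟩ := Finset.mem_filter.1 hj
  set A : ℝ := ⌊intVec π ⬝ᵥ f⌋ + 1 with hA
  have hAf : 0 < A - intVec π ⬝ᵥ f := by
    rw [hA]; linarith [Int.lt_floor_add_one (intVec π ⬝ᵥ f)]
  set T : Set (Fin 2 → ℝ) :=
    {z | intVec π ⬝ᵥ z = A ∧ τ ⬝ᵥ p i ≤ τ ⬝ᵥ z ∧ τ ⬝ᵥ z ≤ τ ⬝ᵥ p j} with hT
  have hTconv : Convex ℝ T := by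
    intro z hz w hw a b ha hb hab
    obtain ⟨z1, z2, z3⟩ := hz
    obtain ⟨w1, w2, w3⟩ := hw
    obtain rfl : b = 1 - a := by linarith
    simp only [hT, Set.mem_ofPred_eq, dotProduct_add, dotProduct_smul, smul_eq_mul, z1, w1]
    exact ⟨by ring, by nlinarith, by nlinarith⟩
  have hsub : convexHull ℝ S ⊆ T := by
    refine convexHull_min (fun z hz => ?_) hTconv
    obtain ⟨l, hl, rfl⟩ := hSJ z hz
    exact ⟨hF _ hz.2, hmin l hl, hmax l hl⟩
  have hx' := hsub hx
  have hy' := hsub hy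
  -- The hull lies in the segment between the extreme intersections, and two distinct points make it
  -- nondegenerate; hence the two rays are linearly independent.
  have hlt : τ ⬝ᵥ p i < τ ⬝ᵥ p j := by
    by_contra hh
    push Not at hh
    apply hxy
    apply eq_of_dot_eq huv
    · rw [hx'.1, hy'.1]
    · rw [← hτ]; linarith [hx'.2.1, hx'.2.2, hy'.2.1, hy'.2.2]
  have hray : ∀ l, 0 < psi B (r l) → r l = psi B (r l) • (p l - f) := by
    intro l hl
    rw [hp]
    simp only [add_sub_cancel_left, smul_smul]
    rw [mul_one_div_cancel hl.ne', one_smul]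
  have hπr : ∀ l, 0 < psi B (r l) → p l ∈ F f B 0 → 0 < intVec π ⬝ᵥ r l := by
    intro l hl hm
    rw [hray l hl, dotProduct_smul, dotProduct_sub, hF _ hm]
    exact mul_pos hl hAf
  refine ⟨π, ⟨u, v, huv⟩, hf, hψ, i, j, hπr i hψi hpi, hπr j hψj hpj, ?_, x, y,
    fun h => hxy (by rw [h]), ?_⟩
  · have e : ∀ a b : Fin 2 → ℝ,
        rdet a b = (intVec π ⬝ᵥ a) * (τ ⬝ᵥ b) - (τ ⬝ᵥ a) * (intVec π ⬝ᵥ b) := by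
      intro a b
      rw [dot_eq, dot_eq, dot_eq, dot_eq, hτ, rdet]
      simp only [intVec, cons_val_zero, cons_val_one]
      push_cast
      linear_combination -(a 0 * b 1 - a 1 * b 0) * huv'
    rw [hray i hψi, hray j hψj, e]
    simp only [dotProduct_smul, dotProduct_sub, smul_eq_mul, hF _ hpi, hF _ hpj]
    have := mul_pos (mul_pos hψi hψj) (mul_pos hAf (sub_pos.2 hlt))
    linarith
  · intro z hz
    have hz' : intVec z ∈ T := by
      rcases hz with rfl | rfl
      · exact hx'
      · exact hy'
    refine ⟨hz'.1, ?_⟩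
    have hd := sub_pos.2 hlt
    set θ := (τ ⬝ᵥ intVec z - τ ⬝ᵥ p i) / (τ ⬝ᵥ p j - τ ⬝ᵥ p i) with hθ
    have hθ0 : 0 ≤ θ := div_nonneg (by linarith [hz'.2.1]) hd.le
    have hθ1 : θ ≤ 1 := by rw [hθ, div_le_one hd]; linarith [hz'.2.2]
    have e : intVec z = (1 - θ) • p i + θ • p j := by
      apply eq_of_dot_eq huv
      · rw [dotProduct_add, dotProduct_smul, dotProduct_smul, hF _ hpi, hF _ hpj, hz'.1]
        simp only [smul_eq_mul]; ring
      · rw [← hτ, dotProduct_add, dotProduct_smul, dotProduct_smul]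
        simp only [smul_eq_mul]
        have : θ * (τ ⬝ᵥ p j - τ ⬝ᵥ p i) = τ ⬝ᵥ intVec z - τ ⬝ᵥ p i := div_mul_cancel₀ _ hd.ne'
        linarith
    refine ⟨(1 - θ) * (1 / psi B (r i)), θ * (1 / psi B (r j)),
      mul_nonneg (by linarith) (one_div_pos.2 hψi).le, mul_nonneg hθ0 (one_div_pos.2 hψj).le, ?_⟩
    rw [e, hp]
    module

/-! ### Passing from real to integer cone coordinates -/

lemma idot_clearDen (π : Fin 2 → ℤ) (v : Fin 2 → ℚ) :
    ((idot π (clearDen v) : ℤ) : ℝ) = scale v * (intVec π ⬝ᵥ toReal v) := by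
  rw [idot, dot_eq]
  push_cast
  simp only [clearDen_eq, intVec]
  ring

lemma idet_clearDen (v w : Fin 2 → ℚ) :
    ((idet (clearDen v) (clearDen w) : ℤ) : ℝ) =
      scale v * scale w * rdet (toReal v) (toReal w) := by
  rw [idet, rdet]
  push_cast
  simp only [clearDen_eq]
  ring

lemma scale_pos' (v : Fin 2 → ℚ) : (0 : ℝ) < scale v := by exact_mod_cast scale_pos v

lemma idot_clearDen_pos {π : Fin 2 → ℤ} {v : Fin 2 → ℚ} (h : 0 < intVec π ⬝ᵥ toReal v) :
    0 < idot π (clearDen v) := by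
  have := mul_pos (scale_pos' v) h
  rw [← idot_clearDen] at this
  exact_mod_cast this

lemma idet_clearDen_pos {v w : Fin 2 → ℚ} (h : 0 < rdet (toReal v) (toReal w)) :
    0 < idet (clearDen v) (clearDen w) := by
  have := mul_pos (mul_pos (scale_pos' v) (scale_pos' w)) h
  rw [← idet_clearDen] at this
  exact_mod_cast this

lemma scale_mul_floor_lt {π : Fin 2 → ℤ} {f : Fin 2 → ℚ}
    (hf : Int.fract (intVec π ⬝ᵥ toReal f) ≠ 0) :
    scale f * (⌊intVec π ⬝ᵥ toReal f⌋ + 1 - 1) < idot π (clearDen f) := by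
  have h0 : 0 < Int.fract (intVec π ⬝ᵥ toReal f) := lt_of_le_of_ne (Int.fract_nonneg _) hf.symm
  have h1 := Int.self_sub_floor (intVec π ⬝ᵥ toReal f)
  have : (scale f : ℝ) * ⌊intVec π ⬝ᵥ toReal f⌋ < scale f * (intVec π ⬝ᵥ toReal f) :=
    mul_lt_mul_of_pos_left (by linarith) (scale_pos' f)
  rw [← idot_clearDen] at this
  rw [add_sub_cancel_right]
  exact_mod_cast this

lemma inCone_of_eq {f v w : Fin 2 → ℚ} {z : Fin 2 → ℤ} {s t : ℝ} (hs : 0 ≤ s) (ht : 0 ≤ t)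
    (hd : 0 < rdet (toReal v) (toReal w))
    (h : intVec z - toReal f = s • toReal v + t • toReal w) :
    InCone (scale f) (clearDen f) (clearDen v) (clearDen w) z := by
  have h0 := congrFun h 0
  have h1 := congrFun h 1
  simp only [Pi.sub_apply, Pi.add_apply, Pi.smul_apply, smul_eq_mul, intVec] at h0 h1
  have hf := scale_pos' f
  have hv := scale_pos' v
  have hw := scale_pos' w
  constructor
  · have e : ((idet (scale f • z - clearDen f) (clearDen w) : ℤ) : ℝ) =
        scale f * scale w * (s * rdet (toReal v) (toReal w)) := by
      simp only [idet, rdet, Pi.sub_apply, Pi.smul_apply, smul_eq_mul]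
      push_cast
      simp only [clearDen_eq]
      linear_combination (scale f * scale w * toReal w 1 : ℝ) * h0 -
        (scale f * scale w * toReal w 0 : ℝ) * h1
    have : (0 : ℝ) ≤ ((idet (scale f • z - clearDen f) (clearDen w) : ℤ) : ℝ) := by
      rw [e]; positivity
    exact_mod_cast this
  · have e : ((idet (clearDen v) (scale f • z - clearDen f) : ℤ) : ℝ) =
        scale f * scale v * (t * rdet (toReal v) (toReal w)) := by
      simp only [idet, rdet, Pi.sub_apply, Pi.smul_apply, smul_eq_mul]
      push_cast
      simp only [clearDen_eq]
      linear_combination (scale f * scale v * toReal v 0 : ℝ) * h1 -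
        (scale f * scale v * toReal v 1 : ℝ) * h0
    have : (0 : ℝ) ≤ ((idet (clearDen v) (scale f • z - clearDen f) : ℤ) : ℝ) := by
      rw [e]; positivity
    exact_mod_cast this

/-! ### Covering `Ξ₀` by families with at most one member -/

/-- Vectors of splits that have no ray in their recession cone and integral intersections with
all rays. -/
def integralVectors {k : ℕ} (f : Fin 2 → ℝ) (r : Fin k → Fin 2 → ℝ) : Set (Fin k → ℝ) :=
  {γ | ∃ π : Fin 2 → ℤ, Int.fract (intVec π ⬝ᵥ f) ≠ 0 ∧ (∀ j, intVec π ⬝ᵥ r j ≠ 0) ∧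
    (∀ j, f + (1 / splitGauge f π (r j)) • r j ∈ intPoints) ∧ γ = fun j => splitGauge f π (r j)}

/-- Vectors of splits that have the `j`-th ray in their recession cone. -/
def parallelVectors {k : ℕ} (f : Fin 2 → ℝ) (r : Fin k → Fin 2 → ℝ) (j : Fin k) :
    Set (Fin k → ℝ) :=
  {γ | ∃ π : Fin 2 → ℤ, IsCoprime (π 0) (π 1) ∧ Int.fract (intVec π ⬝ᵥ f) ≠ 0 ∧
    intVec π ⬝ᵥ r j = 0 ∧ γ = fun j => splitGauge f π (r j)}

/-- Vectors of splits with a facet that contains two corners, with prescribed labels, of the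
cone spanned by the `i`-th and the `j`-th ray. -/
def cornerVectors {k : ℕ} (f : Fin 2 → ℚ) (r : Fin k → Fin 2 → ℚ) (i j : Fin k)
    (l l' : ℕ × ℕ) : Set (Fin k → ℝ) :=
  {γ | ∃ π : Fin 2 → ℤ, IsCoprime (π 0) (π 1) ∧ Int.fract (intVec π ⬝ᵥ toReal f) ≠ 0 ∧
    0 < idot π (clearDen (r i)) ∧ 0 < idot π (clearDen (r j)) ∧
    0 < idet (clearDen (r i)) (clearDen (r j)) ∧ (∃ x y : Fin 2 → ℤ, x ≠ y ∧
      IsCorner (scale f) (clearDen f) (clearDen (r i)) (clearDen (r j)) π x ∧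
      IsCorner (scale f) (clearDen f) (clearDen (r i)) (clearDen (r j)) π y ∧
      idot π x = ⌊intVec π ⬝ᵥ toReal f⌋ + 1 ∧ idot π y = ⌊intVec π ⬝ᵥ toReal f⌋ + 1 ∧
      coneLabel (scale f) (clearDen f) (clearDen (r i)) (clearDen (r j)) x = l ∧
      coneLabel (scale f) (clearDen f) (clearDen (r i)) (clearDen (r j)) y = l') ∧
    γ = fun j => splitGauge (toReal f) π (toReal (r j))}

lemma not_lt_of_integral {f r : Fin 2 → ℝ} {π π' : Fin 2 → ℤ}
    (hf : Int.fract (intVec π ⬝ᵥ f) ≠ 0)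
    (hr : intVec π ⬝ᵥ r ≠ 0) (hint : f + (1 / splitGauge f π' r) • r ∈ intPoints) :
    ¬ splitGauge f π r < splitGauge f π' r := by
  intro hlt
  have h0 : 0 < splitGauge f π r :=
    lt_of_le_of_ne (splitGauge_nonneg r) fun h => hr ((splitGauge_eq_zero_iff hf r).1 h.symm)
  have hg := h0.trans hlt
  obtain ⟨z, hz⟩ := exists_intVec_of_mem hint
  set t := 1 / splitGauge f π' r with ht
  -- A point further along the ray is still in the strip of `π`, so the integer point at parameter
  -- `t` lies strictly inside it.
  obtain ⟨t', ht1, ht2⟩ := exists_between (one_div_lt_one_div_of_lt h0 hlt)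
  have htp : 0 < t := one_div_pos.2 hg
  have ht1' : t < t' := ht1
  have hm : f + t' • r ∈ strip π ⌊intVec π ⬝ᵥ f⌋ := by
    rw [add_smul_mem_strip_iff hf r (htp.trans ht1')]
    exact ((lt_div_iff₀ h0).1 ht2).le
  obtain ⟨h1, h2⟩ := hm
  have hφ : 0 < Int.fract (intVec π ⬝ᵥ f) := lt_of_le_of_ne (Int.fract_nonneg _) hf.symm
  have hfl := Int.self_sub_floor (intVec π ⬝ᵥ f)
  have hfl' := Int.fract_lt_one (intVec π ⬝ᵥ f)
  have hz' : intVec π ⬝ᵥ f + t * (intVec π ⬝ᵥ r) = ((π 0 * z 0 + π 1 * z 1 : ℤ) : ℝ) := by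
    rw [← intVec_dot, ← hz, dotProduct_add, dotProduct_smul, smul_eq_mul]
  rw [dotProduct_add, dotProduct_smul, smul_eq_mul] at h1 h2
  set w := π 0 * z 0 + π 1 * z 1
  have a1 : (⌊intVec π ⬝ᵥ f⌋ : ℝ) < w := by
    rw [← hz']
    rcases lt_or_gt_of_ne hr with h | h
    · nlinarith
    · nlinarith
  have a2 : (w : ℝ) < ⌊intVec π ⬝ᵥ f⌋ + 1 := by
    rw [← hz']
    rcases lt_or_gt_of_ne hr with h | h
    · nlinarith
    · nlinarith
  have b1 : ⌊intVec π ⬝ᵥ f⌋ < w := by exact_mod_cast a1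
  have b2 : w < ⌊intVec π ⬝ᵥ f⌋ + 1 := by exact_mod_cast a2
  omega

lemma subsingleton_integralVectors {k : ℕ} (f : Fin 2 → ℝ) (r : Fin k → Fin 2 → ℝ) :
    (integralVectors f r).Subsingleton := by
  rintro _ ⟨π, hf, hr, hi, rfl⟩ _ ⟨π', hf', hr', hi', rfl⟩
  ext j
  exact le_antisymm (not_lt.1 (not_lt_of_integral hf' (hr' j) (hi j)))
    (not_lt.1 (not_lt_of_integral hf (hr j) (hi' j)))

lemma subsingleton_parallelVectors {k : ℕ} (f : Fin 2 → ℝ) (r : Fin k → Fin 2 → ℝ) (j : Fin k)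
    (hj : r j ≠ 0) : (parallelVectors f r j).Subsingleton := by
  rintro _ ⟨π, hπ, hf, hr, rfl⟩ _ ⟨π', hπ', hf', hr', rfl⟩
  rw [splitGauge_eq_of_perp hπ hf hπ' hj hr hr']

lemma subsingleton_cornerVectors {k : ℕ} (f : Fin 2 → ℚ) (r : Fin k → Fin 2 → ℚ) (i j : Fin k)
    (l l' : ℕ × ℕ) : (cornerVectors f r i j l l').Subsingleton := by
  rintro _ ⟨π, hπ, hf, ha, hb, hD, ⟨x, y, hxy, hx, hy, hxc, hyc, hxl, hyl⟩, rfl⟩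
    _ ⟨π', hπ', hf', ha', hb', hD', ⟨x', y', hxy', hx', hy', hxc', hyc', hxl', hyl'⟩, rfl⟩
  have hq := scale_pos f
  have hc := scale_mul_floor_lt hf
  obtain rfl := hx.eq_of_label_eq hq hD ha hb hc hxc hx'.1 (hxl.trans hxl'.symm)
  obtain rfl := hy.eq_of_label_eq hq hD ha hb hc hyc hy'.1 (hyl.trans hyl'.symm)
  have hd : intVec (x - y) ≠ 0 := intVec_ne_zero (sub_ne_zero.2 hxy)
  have e : ∀ π : Fin 2 → ℤ, idot π x = idot π y → intVec π ⬝ᵥ intVec (x - y) = 0 := by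
    intro π h
    rw [intVec_dot]
    have : idot π (x - y) = 0 := by rw [idot_sub, h, sub_self]
    exact_mod_cast this
  rw [splitGauge_eq_of_perp hπ hf hπ' hd (e π (hxc.trans hyc.symm)) (e π' (hxc'.trans hyc'.symm))]

lemma mem_cornerVectors_of_caseC {k : ℕ} {f : Fin 2 → ℚ} {r : Fin k → Fin 2 → ℚ}
    {B : Matrix (Fin 3) (Fin 2) ℝ} (hB : IsMaximalSplit (toReal f) B)
    (hC : CaseC (toReal f) (fun j => toReal (r j)) B) :
    ∃ (i j : Fin k) (l l' : Fin (3 * inputSize f r + 2) × Fin (3 * inputSize f r + 2)),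
      gam (fun j => toReal (r j)) B ∈ cornerVectors f r i j (l.1, l.2) (l'.1, l'.2) := by
  obtain ⟨π, hπ, hf, hψ, i, j, hi, hj, hd, x, y, hxy, hz⟩ := hC.exists_cone hB
  have hq := scale_pos f
  have ha := idot_clearDen_pos hi
  have hb := idot_clearDen_pos hj
  have hD := idet_clearDen_pos hd
  have hc := scale_mul_floor_lt hf
  have hcone : ∀ z, z = x ∨ z = y →
      InCone (scale f) (clearDen f) (clearDen (r i)) (clearDen (r j)) z ∧
      idot π z = ⌊intVec π ⬝ᵥ toReal f⌋ + 1 := by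
    intro z h
    obtain ⟨h1, s, t, hs, ht, h2⟩ := hz z h
    refine ⟨inCone_of_eq hs ht hd h2, ?_⟩
    rw [intVec_dot] at h1
    exact_mod_cast h1
  obtain ⟨hx, hxc⟩ := hcone x (Or.inl rfl)
  obtain ⟨hy, hyc⟩ := hcone y (Or.inr rfl)
  obtain ⟨x', y', hxy', hx', hy', hxc', hyc'⟩ :=
    exists_isCorner_ne hq ha hb hx hy hxc hyc hxy
  have hm := scale_mul_idet_le (N := inputSize f r) f (r i) (r j) (Nat.le_add_right _ _)
    (vecSize_le_inputSize f r i) (vecSize_le_inputSize f r j)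
  obtain ⟨lx1, lx2⟩ := hx'.1.label_lt hq hD ha hb hc hxc' hm
  obtain ⟨ly1, ly2⟩ := hy'.1.label_lt hq hD ha hb hc hyc' hm
  refine ⟨i, j, (⟨_, lx1⟩, ⟨_, lx2⟩), (⟨_, ly1⟩, ⟨_, ly2⟩), π, hπ, hf, ha, hb, hD,
    ⟨x', y', hxy', hx', hy', hxc', hyc', rfl, rfl⟩, ?_⟩
  ext l
  exact hψ _

lemma finite_and_ncard_le_of_subset_iUnion {α ι : Type*} [Fintype ι] {S : Set α} {T : ι → Set α}
    (hT : ∀ i, (T i).Subsingleton) (hS : S ⊆ ⋃ i, T i) :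
    S.Finite ∧ S.ncard ≤ Fintype.card ι := by
  have h : ∀ x : S, ∃ i, (x : α) ∈ T i := fun x => Set.mem_iUnion.1 (hS x.2)
  choose g hg using h
  have hinj : Function.Injective g := fun x y hxy =>
    Subtype.ext (hT _ (hg x) (hxy ▸ hg y))
  have := Finite.of_injective g hinj
  refine ⟨Set.toFinite S, ?_⟩
  rw [← Nat.card_coe_set_eq, ← Nat.card_eq_fintype_card]
  exact Nat.card_le_card_of_injective g hinj

/-- Case a says nothing about a ray with `ψ_B = 0`, so a split with a parallel ray is always counted
by that ray. -/
lemma mem_integralVectors_or_mem_parallelVectors {k : ℕ} {f : Fin 2 → ℝ}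
    {r : Fin k → Fin 2 → ℝ} {B : Matrix (Fin 3) (Fin 2) ℝ} (hB : IsMaximalSplit f B)
    (h : CaseA f r B ∨ CaseB f r B) :
    gam r B ∈ integralVectors f r ∨ ∃ j, gam r B ∈ parallelVectors f r j := by
  obtain ⟨π, hπ, hf, hM, hψ⟩ := hB.exists_coprime
  have hγ : gam r B = fun j => splitGauge f π (r j) := funext fun j => hψ _
  by_cases h0 : ∃ j, intVec π ⬝ᵥ r j = 0
  · obtain ⟨j, hj⟩ := h0
    exact Or.inr ⟨j, π, hπ, hf, hj, hγ⟩
  · push Not at h0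
    have hpos : ∀ j, 0 < psi B (r j) := by
      intro j
      rw [hψ]
      exact lt_of_le_of_ne (splitGauge_nonneg _) fun h =>
        h0 j ((splitGauge_eq_zero_iff hf _).1 h.symm)
    rcases h with h | ⟨j, hj⟩
    · refine Or.inl ⟨π, hf, h0, fun j => ?_, hγ⟩
      rw [← hψ]
      exact h ⟨r j, ⟨j, rfl⟩, hpos j, rfl⟩
    · exfalso
      have hfm : f ∈ M f B := fun i => by simp
      -- Twice the exit parameter already takes the ray outside `M(B)`.
      have ht : 0 < 2 / psi B (r j) := div_pos two_pos (hpos j)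
      have := hj f hfm _ ht.le
      rw [add_smul_mem_M_iff f B _ ht, div_mul_cancel₀ _ (hpos j).ne'] at this
      norm_num at this

theorem finite_Xi0_and_ncard_le {k : ℕ} (f : Fin 2 → ℚ) (r : Fin k → Fin 2 → ℚ)
    (hr : ∀ j, r j ≠ 0) :
    (Xi0 (toReal f) (fun j => toReal (r j))).Finite ∧
      (Xi0 (toReal f) (fun j => toReal (r j))).ncard ≤
        1 + (k + k * k * ((3 * inputSize f r + 2) * (3 * inputSize f r + 2) *
          ((3 * inputSize f r + 2) * (3 * inputSize f r + 2)))) := by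
  set m := 3 * inputSize f r + 2 with hm
  let T : Unit ⊕ Fin k ⊕ (Fin k × Fin k) × (Fin m × Fin m) × (Fin m × Fin m) →
      Set (Fin k → ℝ) := Sum.elim (fun _ => integralVectors (toReal f) fun j => toReal (r j))
    (Sum.elim (parallelVectors (toReal f) fun j => toReal (r j))
      fun l => cornerVectors f r l.1.1 l.1.2 (l.2.1.1, l.2.1.2) (l.2.2.1, l.2.2.2))
  have key := finite_and_ncard_le_of_subset_iUnion (T := T)
    (S := Xi0 (toReal f) (fun j => toReal (r j))) ?_ ?_
  · simpa using key
  · rintro (_ | j | l)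
    · exact subsingleton_integralVectors _ _
    · refine subsingleton_parallelVectors (toReal f) (fun j => toReal (r j)) j fun h => hr j ?_
      ext i
      have := congrFun h i
      simpa [toReal] using this
    · exact subsingleton_cornerVectors _ _ _ _ _ _
  · rintro _ ⟨B, hB, h, rfl⟩
    rw [Set.mem_iUnion]
    rw [← or_assoc] at h
    rcases h with h | h
    · rcases mem_integralVectors_or_mem_parallelVectors hB h with h | ⟨j, h⟩
      · exact ⟨Sum.inl (), h⟩
      · exact ⟨Sum.inr (Sum.inl j), h⟩
    · obtain ⟨i, j, l, l', h⟩ := mem_cornerVectors_of_caseC hB h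
      exact ⟨Sum.inr (Sum.inr ((i, j), l, l')), h⟩

end SplitCounting

theorem proposition3p8 :
    ∃ q : Polynomial ℕ, ∀ (k : ℕ) (f : Fin 2 → ℚ) (r : Fin k → Fin 2 → ℚ),
      (∀ j, r j ≠ 0) →
      SplitCounting.Xi0 (SplitCounting.toReal f) (fun j => SplitCounting.toReal (r j)) ⊆
        SplitCounting.splitVectors (SplitCounting.toReal f)
          (fun j => SplitCounting.toReal (r j)) ∧
      (SplitCounting.Xi0 (SplitCounting.toReal f)
        (fun j => SplitCounting.toReal (r j))).Finite ∧
      (SplitCounting.Xi0 (SplitCounting.toReal f)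
        (fun j => SplitCounting.toReal (r j))).ncard ≤
          q.eval (SplitCounting.inputSize f r) ∧
      ∀ γ ∈ SplitCounting.splitVectors (SplitCounting.toReal f)
            (fun j => SplitCounting.toReal (r j)) \
          SplitCounting.Xi0 (SplitCounting.toReal f) (fun j => SplitCounting.toReal (r j)),
        ∃ γ₁ ∈ SplitCounting.Delta (SplitCounting.toReal f)
            (fun j => SplitCounting.toReal (r j)),
        ∃ γ₂ ∈ SplitCounting.Delta (SplitCounting.toReal f)
            (fun j => SplitCounting.toReal (r j)),
          SplitCounting.IsStrictConvexComb γ γ₁ γ₂ := by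
  -- The variable also replaces `k`, as each ray contributes at least one to the input size.
  refine ⟨1 + (Polynomial.X + Polynomial.X * Polynomial.X * (3 * Polynomial.X + 2) ^ 4), ?_⟩
  intro k f r hr
  obtain ⟨hfin, hcard⟩ := SplitCounting.finite_Xi0_and_ncard_le f r hr
  refine ⟨?_, hfin, hcard.trans ?_, fun γ hγ =>
    SplitCounting.exists_strictConvexComb hγ.1 hγ.2⟩
  · rintro γ ⟨B, hB, -, rfl⟩
    exact ⟨B, hB, rfl⟩
  · have hk := SplitCounting.le_inputSize f r
    simp only [Polynomial.eval_add, Polynomial.eval_mul, Polynomial.eval_pow,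
      Polynomial.eval_one, Polynomial.eval_X, Polynomial.eval_ofNat]
    rw [show ∀ m : ℕ, m ^ 4 = m * m * (m * m) from fun m => by ring]
    gcongr
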